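/- **Setting.** Let $\varepsilon_0,\varepsilon,\tau>0$, $\lambda\in\mathbb R\setminus\{0\}$, $\beta\in\mathbb R$, and put $\eta=\big(\frac{(\varepsilon-\varepsilon_0)\tau}{2\pi}\big)^2$, $\xi=\big(\frac{\lambda\tau}{\pi}\big)^2$. Let $\mathcal H$ be the bosonic Fock space over $\mathbb C$, with Fock basis $(|n\rangle)_{n\in\mathbb N}$, creation and annihilation operators $a^*,a$ and number operator $N=a^*a$. Let $p_{\rm at}(-)=\frac1{1+e^{-\beta\varepsilon}}$, $p_{\rm at}(+)=\frac{e^{-\beta\varepsilon}}{1+e^{-\beta\varepsilon}}$, $$C(n)=\cos(\pi\sqrt{\xi n+\eta})+i\eta^{1/2}\,\frac{\sin(\pi\sqrt{\xi n+\eta})}{\sqrt{\xi n+\eta}},\qquad S(n)=\xi^{1/2}\,\frac{\sin(\pi\sqrt{\xi n+\eta})}{\sqrt{\xi n+\eta}}$$ (with $\sin(\pi\sqrt x)/\sqrt x=\pi$ at $x=0$), and let the one-atom maser Kraus operators be the bounded operators $$V_{--}=p_{\rm at}(-)^{1/2}e^{-i\tau\varepsilon N}C(N),\qquad V_{-+}=p_{\rm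 at}(-)^{1/2}e^{-i\tau\varepsilon N}S(N+1)a,$$ $$V_{+-}=p_{\rm at}(+)^{1/2}e^{-i\tau\varepsilon N}S(N)a^*,\qquad V_{++}=p_{\rm at}(+)^{1/2}e^{-i\tau\varepsilon N}C(N+1)^*.$$ Let $\Omega=(\{-,+\}^2)^{\mathbb N^*}$ with the $\sigma$-algebra generated by the cylinders, and $W_t(\omega)=V_{\omega_t}\cdots V_{\omega_1}$. A state is a positive semidefinite trace class operator on $\mathcal H$ with unit trace; $\|\cdot\|_1$ is the trace norm. For a state $\rho$, $\mathbb P^\rho$ is the probability measure on $\Omega$ under which the first $t$ outcomes are $\omega_1,\dots,\omega_t$ with probability ${\rm Tr}(W_t(\omega)\rho W_t(\omega)^*)$, for all $t$ and $\omega$. If $\beta>0$, $\rho_{\rm inv}=e^{-\beta\varepsilon N}/{\rm Tr}(e^{-\beta\varepsilon N})$. Let $s_t(\omega)=\sum_{u=1}^t\delta(\omega_u)$, with $\delta(+,-)=1$, $\delta(-,+)=-1$ and $\delta=0$ otherwise. For $k\in\mathbb N$ let $\tau^k(\omega)=\inf\{t\ge1: W_t(\omega)|k\rangle=0\}\in\mathbb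 N^*\cup\{+\infty\}$, and let $N_t(k,\omega)=k+s_t(\omega)$ if $t<\tau^k(\omega)$, $N_t(k,\omega)=-1$ otherwise. Here $|-1\rangle$ denotes an arbitrary unit vector which is not one of the Fock vectors $|k\rangle$, $k\in\mathbb N$. **Theorem.** Suppose that $\beta>0$ and that there is no Rabi resonance, i.e. there are no positive integers $n,k$ with $\xi n+\eta=k^2$. Then there exists a random variable $n_\infty:\Omega\to\mathbb N$ such that 1. for every state $\rho$ and every $n\in\mathbb N$, $\mathbb P^\rho(n_\infty=n)=\langle n,\rho\, n\rangle$; in particular $\mathbb E^{\rho_{\rm inv}}\big(|n_\infty\rangle\langle n_\infty|\big)=\rho_{\rm inv}$; 2. $\tau^{n_\infty}=+\infty$ $\mathbb P^{\rho_{\rm inv}}$-almost surely, and also $\mathbb P^\rho$-almost surely for every state $\rho$; 3. for every initial state $\rho$, the quantum trajectory $\rho_t=\dfrac{W_t\rho W_t^*}{{\rm Tr}(W_t\rho W_t^*)}$ satisfies, $\mathbb P^\rho$-almost surely and in $L^1(\mathbb P^\rho)$, $$\lim_{t\to+\infty}\Big\|\rho_t-|N_t(n_\infty,\cdot)\rangle\langle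 N_t(n_\infty,\cdot)|\Big\|_1=0.$$ -/

import Mathlib

open MeasureTheory Filter Topology
open scoped ENNReal

noncomputable section

namespace Maser

/-! ### The cavity Hilbert space and trace class operators -/

/-- The bosonic Fock space over `ℂ`, realised as `ℓ²(ℕ)`: the `n`-th coordinate of a vector is its
component in the `n`-photon sector. -/
def Cavity : Type := lp (fun _ : ℕ => ℂ) 2

instance instNormedAddCommGroupCavity : NormedAddCommGroup Cavity :=
  inferInstanceAs (NormedAddCommGroup (lp (fun _ : ℕ => ℂ) 2))

instance instInnerProductSpaceCavity : InnerProductSpace ℂ Cavity :=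
  inferInstanceAs (InnerProductSpace ℂ (lp (fun _ : ℕ => ℂ) 2))

instance instCompleteSpaceCavity : CompleteSpace Cavity :=
  inferInstanceAs (CompleteSpace (lp (fun _ : ℕ => ℂ) 2))

/-- The Fock basis of the cavity space. -/
def fockBasis : HilbertBasis ℕ ℂ Cavity :=
  HilbertBasis.ofRepr (LinearIsometryEquiv.refl ℂ (lp (fun _ : ℕ => ℂ) 2))

/-- The Fock vector `|n⟩`. -/
def fock (n : ℕ) : Cavity := fockBasis n

/-- The operator `|φ⟩⟨φ|`. -/
def ketBra (φ : Cavity) : Cavity →L[ℂ] Cavity := InnerProductSpace.rankOne ℂ φ φ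

/-- The trace `∑ₙ ⟨n, T n⟩` (used for trace class operators). -/
def trace (T : Cavity →L[ℂ] Cavity) : ℂ := ∑' n : ℕ, inner ℂ (fock n) (T (fock n))

/-- The trace norm `‖T‖₁ = Tr |T|`, with `|T| = (T* T)^{1/2}`; it is `∞` when `T` is not
trace class. -/
def traceNorm (T : Cavity →L[ℂ] Cavity) : ℝ≥0∞ :=
  ∑' n : ℕ, ENNReal.ofReal (inner ℂ (fock n) (CFC.abs T (fock n))).re

/-- Density operators: positive semidefinite trace class operators with unit trace. -/
structure IsState (ρ : Cavity →L[ℂ] Cavity) : Prop where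
  isPositive : ρ.IsPositive
  traceClass : traceNorm ρ < ∞
  trace_eq_one : trace ρ = 1

/-! ### Parameters of the one-atom maser -/

/-- The parameters: the frequency `ε₀` of the cavity mode, the Bohr frequency `ε` of the atoms,
half the Rabi frequency `lam`, the interaction time `τ`, the inverse temperature `β`. -/
structure Params where
  ε₀ : ℝ
  ε : ℝ
  lam : ℝ
  τ : ℝ
  β : ℝ

/-- The dimensionless detuning parameter `η = (Δτ/2π)²`, with `Δ = ε - ε₀`. -/
def Params.η (m : Params) : ℝ := ((m.ε - m.ε₀) * m.τ / (2 * Real.pi)) ^ 2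

/-- The dimensionless coupling constant `ξ = (λτ/π)²`. -/
def Params.ξ (m : Params) : ℝ := (m.lam * m.τ / Real.pi) ^ 2

/-- There is no Rabi resonance: no positive integer `n` such that `ξ n + η` is the square of a
positive integer. -/
def Params.NonResonant (m : Params) : Prop :=
  ∀ n k : ℕ, 0 < n → 0 < k → m.ξ * n + m.η ≠ (k : ℝ) ^ 2

/-- The probabilities `p_at(∓)` that an atom enters in its ground (`false`, i.e. `-`), resp.
excited (`true`, i.e. `+`), state. -/
def Params.pAt (m : Params) : Bool → ℝ
  | false => 1 / (1 + Real.exp (-m.β * m.ε))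
  | true => Real.exp (-m.β * m.ε) / (1 + Real.exp (-m.β * m.ε))

/-- The value `sin(π √x) / √x`, with its limit `π` at `x = 0`, at `x = ξ n + η`. -/
def Params.sinQuot (m : Params) (n : ℕ) : ℝ :=
  Real.pi * Real.sinc (Real.pi * √(m.ξ * n + m.η))

/-- `C(n) = cos(π √(ξ n + η)) + i η^{1/2} sin(π √(ξ n + η)) / √(ξ n + η)`. -/
def Params.C (m : Params) (n : ℕ) : ℂ :=
  (Real.cos (Real.pi * √(m.ξ * n + m.η)) : ℂ) + Complex.I * (√m.η : ℂ) * (m.sinQuot n : ℂ)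

/-- `S(n) = ξ^{1/2} sin(π √(ξ n + η)) / √(ξ n + η)`. -/
def Params.S (m : Params) (n : ℕ) : ℝ := √m.ξ * m.sinQuot n

/-! ### The Kraus operators

They are first written as operators on all complex sequences, with the expressions for the
creation, annihilation and number operators in the Fock basis, and are then shown to restrict to
contractions of `ℓ²(ℕ)`. -/

/-- The function `f(N)` of the number operator. -/
def numberFun (f : ℕ → ℂ) : (ℕ → ℂ) →ₗ[ℂ] (ℕ → ℂ) where
  toFun ψ n := f n * ψ n
  map_add' ψ φ := by ext n; simp [mul_add]
  map_smul' c ψ := by ext n; simp; ring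

/-- The annihilation operator, `a |n⟩ = √n |n-1⟩`. -/
def annihilation : (ℕ → ℂ) →ₗ[ℂ] (ℕ → ℂ) where
  toFun ψ n := (√((n : ℝ) + 1) : ℂ) * ψ (n + 1)
  map_add' ψ φ := by ext n; simp [mul_add]
  map_smul' c ψ := by ext n; simp; ring

/-- The creation operator, `a* |n⟩ = √(n+1) |n+1⟩`. -/
def creation : (ℕ → ℂ) →ₗ[ℂ] (ℕ → ℂ) where
  toFun ψ n := (√(n : ℝ) : ℂ) * ψ (n - 1)
  map_add' ψ φ := by ext n; simp [mul_add]
  map_smul' c ψ := by ext n; simp; ring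

/-- The phase `e^{-iτεn}`. -/
def Params.phase (m : Params) (n : ℕ) : ℂ :=
  Complex.exp (-(Complex.I * (m.τ : ℂ) * (m.ε : ℂ) * (n : ℂ)))

/-- A pair of measurement results `(σ, σ')`, before and after the interaction
(`false` is `-`, `true` is `+`). -/
abbrev Outcome : Type := Bool × Bool

/-- The expressions
`V₋₋ = p_at(-)^{1/2} e^{-iτεN} C(N)`, `V₋₊ = p_at(-)^{1/2} e^{-iτεN} S(N+1) a`,
`V₊₋ = p_at(+)^{1/2} e^{-iτεN} S(N) a*`, `V₊₊ = p_at(+)^{1/2} e^{-iτεN} C(N+1)*`. -/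
def Params.krausSeq (m : Params) : Outcome → ((ℕ → ℂ) →ₗ[ℂ] (ℕ → ℂ))
  | (false, false) =>
      (√(m.pAt false) : ℂ) • (numberFun m.phase ∘ₗ numberFun m.C)
  | (false, true) =>
      (√(m.pAt false) : ℂ) • (numberFun m.phase ∘ₗ numberFun (fun n => (m.S (n + 1) : ℂ)) ∘ₗ
        annihilation)
  | (true, false) =>
      (√(m.pAt true) : ℂ) • (numberFun m.phase ∘ₗ numberFun (fun n => (m.S n : ℂ)) ∘ₗ creation)
  | (true, true) =>
      (√(m.pAt true) : ℂ) • (numberFun m.phase ∘ₗ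
        numberFun (fun n => (starRingEnd ℂ) (m.C (n + 1))))

/-- The position whose coordinate enters the `n`-th coordinate of `V_y ψ`. -/
def src : Outcome → ℕ → ℕ
  | (false, false), n => n
  | (false, true), n => n + 1
  | (true, false), n => n - 1
  | (true, true), n => n

/-- The matrix element of `V_y` between `src y n` and `n`. -/
def Params.amp (m : Params) (y : Outcome) (n : ℕ) : ℂ :=
  match y with
  | (false, false) => (√(m.pAt false) : ℂ) * (m.phase n * m.C n)
  | (false, true) =>
      (√(m.pAt false) : ℂ) * (m.phase n * ((m.S (n + 1) : ℂ) * (√((n : ℝ) + 1) : ℂ)))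
  | (true, false) => (√(m.pAt true) : ℂ) * (m.phase n * ((m.S n : ℂ) * (√(n : ℝ) : ℂ)))
  | (true, true) => (√(m.pAt true) : ℂ) * (m.phase n * (starRingEnd ℂ) (m.C (n + 1)))

theorem krausSeq_apply (m : Params) (y : Outcome) (ψ : ℕ → ℂ) (n : ℕ) :
    m.krausSeq y ψ n = m.amp y n * ψ (src y n) := by
  rcases y with ⟨_ | _, _ | _⟩ <;>
    simp [Params.krausSeq, Params.amp, src, numberFun, annihilation, creation, mul_assoc]

theorem Params.ξ_nonneg (m : Params) : 0 ≤ m.ξ := sq_nonneg _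
theorem Params.η_nonneg (m : Params) : 0 ≤ m.η := sq_nonneg _

theorem Params.pAt_nonneg (m : Params) (s : Bool) : 0 ≤ m.pAt s := by
  cases s <;> simp only [Params.pAt] <;> positivity

theorem Params.pAt_add (m : Params) : m.pAt false + m.pAt true = 1 := by
  have : 0 < 1 + Real.exp (-m.β * m.ε) := by positivity
  simp only [Params.pAt]
  field_simp

theorem sin_sq_eq (x : ℝ) (hx : 0 ≤ x) :
    x * (Real.pi * Real.sinc (Real.pi * √x)) ^ 2 = Real.sin (Real.pi * √x) ^ 2 := by
  rcases hx.eq_or_lt with rfl | hx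
  · simp
  · have h1 : √x ≠ 0 := (Real.sqrt_pos.2 hx).ne'
    have h2 : Real.pi * √x ≠ 0 := mul_ne_zero Real.pi_ne_zero h1
    rw [Real.sinc_of_ne_zero h2]
    have h3 : √x ^ 2 = x := Real.sq_sqrt hx.le
    field_simp
    rw [h3]

set_option linter.unusedSimpArgs false in
theorem Params.C_S (m : Params) (n : ℕ) : ‖m.C n‖ ^ 2 + m.S n ^ 2 * n = 1 := by
  have h0 : 0 ≤ m.ξ * n + m.η := add_nonneg (mul_nonneg m.ξ_nonneg n.cast_nonneg) m.η_nonneg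
  have h1 := sin_sq_eq _ h0
  have h2 := Real.sin_sq_add_cos_sq (Real.pi * √(m.ξ * n + m.η))
  have hη := Real.sq_sqrt m.η_nonneg
  have hξ := Real.sq_sqrt m.ξ_nonneg
  have hC : m.C n = ⟨Real.cos (Real.pi * √(m.ξ * n + m.η)), √m.η * m.sinQuot n⟩ := by
    apply Complex.ext <;> simp [Params.C, ← Complex.ofReal_cos, ← Complex.ofReal_mul]
  rw [hC, ← Complex.normSq_eq_norm_sq, Complex.normSq_mk, Params.S]
  simp only [Params.sinQuot]
  rw [mul_pow, hξ, ← pow_two, mul_mul_mul_comm, ← pow_two, hη]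
  linear_combination h2 + h1

theorem Params.norm_phase (m : Params) (n : ℕ) : ‖m.phase n‖ = 1 := by
  rw [Params.phase, show -(Complex.I * (m.τ : ℂ) * (m.ε : ℂ) * (n : ℂ))
    = ((-(m.τ * m.ε * n) : ℝ) : ℂ) * Complex.I by push_cast; ring]
  exact Complex.norm_exp_ofReal_mul_I _

/-- Squared modulus of the matrix element. -/
theorem Params.norm_amp_sq (m : Params) (y : Outcome) (n : ℕ) :
    ‖m.amp y n‖ ^ 2 = match y with
      | (false, false) => m.pAt false * ‖m.C n‖ ^ 2
      | (false, true) => m.pAt false * (m.S (n + 1) ^ 2 * ((n + 1 : ℕ) : ℝ))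
      | (true, false) => m.pAt true * (m.S n ^ 2 * n)
      | (true, true) => m.pAt true * ‖m.C (n + 1)‖ ^ 2 := by
  have hf := Real.sq_sqrt (m.pAt_nonneg false)
  have ht := Real.sq_sqrt (m.pAt_nonneg true)
  have hn : (√(n : ℝ)) ^ 2 = n := Real.sq_sqrt n.cast_nonneg
  have hn1 : (√((n : ℝ) + 1)) ^ 2 = n + 1 := Real.sq_sqrt (by positivity)
  rcases y with ⟨_ | _, _ | _⟩ <;>
    simp [Params.amp, m.norm_phase, mul_pow, hf, ht, hn, hn1]

theorem Params.norm_amp_le (m : Params) (y : Outcome) (n : ℕ) : ‖m.amp y n‖ ≤ 1 := by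
  have h1 := m.pAt_nonneg false
  have h2 := m.pAt_nonneg true
  have h3 := m.pAt_add
  have h4 := m.C_S n
  have h5 := m.C_S (n + 1)
  have h6 : 0 ≤ m.S n ^ 2 * n := by positivity
  have h7 : 0 ≤ m.S (n + 1) ^ 2 * ((n + 1 : ℕ) : ℝ) := by positivity
  have h8 := sq_nonneg ‖m.C n‖
  have h9 := sq_nonneg ‖m.C (n + 1)‖
  have : ‖m.amp y n‖ ^ 2 ≤ 1 := by
    rw [m.norm_amp_sq]
    rcases y with ⟨_ | _, _ | _⟩ <;> simp only <;>
      exact mul_le_one₀ (by linarith) (by linarith) (by linarith)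
  nlinarith [norm_nonneg (m.amp y n)]

theorem summable_coord (ψ : lp (fun _ : ℕ => ℂ) 2) : Summable fun n => ‖ψ n‖ ^ 2 := by
  have := (memℓp_gen_iff (p := 2) (by norm_num)).1 (lp.memℓp ψ)
  simpa using this

theorem norm_sq_coord (ψ : lp (fun _ : ℕ => ℂ) 2) : ‖ψ‖ ^ 2 = ∑' n, ‖ψ n‖ ^ 2 := by
  have := lp.norm_rpow_eq_tsum (p := 2) (by norm_num) ψ
  simpa using this

theorem memℓp_of_summable {f : ℕ → ℂ} (h : Summable fun n => ‖f n‖ ^ 2) :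
    Memℓp (E := fun _ : ℕ => ℂ) f 2 :=
  (memℓp_gen_iff (p := 2) (by norm_num)).2 (by simpa using h)

theorem krausSeq_summable (m : Params) (y : Outcome) (ψ : lp (fun _ : ℕ => ℂ) 2) :
    Summable (fun n => ‖m.krausSeq y ψ n‖ ^ 2) ∧
      ∑' n, ‖m.krausSeq y ψ n‖ ^ 2 ≤ ∑' n, ‖ψ n‖ ^ 2 := by
  have hs := summable_coord ψ
  have hle : ∀ n, ‖m.krausSeq y ψ n‖ ^ 2 ≤ ‖ψ (src y n)‖ ^ 2 := fun n => by
    rw [krausSeq_apply, norm_mul, mul_pow]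
    exact mul_le_of_le_one_left (by positivity) (pow_le_one₀ (norm_nonneg _) (m.norm_amp_le y n))
  have hs1 := (summable_nat_add_iff 1).2 hs
  rcases y with ⟨_ | _, _ | _⟩
  · have := Summable.of_nonneg_of_le (fun n => by positivity) hle hs
    exact ⟨this, this.tsum_le_tsum hle hs⟩
  · have := Summable.of_nonneg_of_le (fun n => by positivity) hle hs1
    refine ⟨this, (this.tsum_le_tsum hle hs1).trans ?_⟩
    rw [hs.tsum_eq_zero_add]
    have : 0 ≤ ‖ψ 0‖ ^ 2 := by positivity
    simp only [src]
    linarith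
  · have h0 : ‖m.krausSeq (true, false) ψ 0‖ ^ 2 = 0 := by
      simp [krausSeq_apply, Params.amp]
    have hle' : ∀ n, ‖m.krausSeq (true, false) ψ (n + 1)‖ ^ 2 ≤ ‖ψ n‖ ^ 2 :=
      fun n => hle (n + 1)
    have h2 := Summable.of_nonneg_of_le (fun n => by positivity) hle' hs
    have h3 : Summable (fun n => ‖m.krausSeq (true, false) ψ n‖ ^ 2) :=
      (summable_nat_add_iff 1).1 h2
    refine ⟨h3, ?_⟩
    rw [h3.tsum_eq_zero_add, h0, zero_add]
    exact h2.tsum_le_tsum hle' hs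
  · have := Summable.of_nonneg_of_le (fun n => by positivity) hle hs
    exact ⟨this, this.tsum_le_tsum hle hs⟩

/-- The restriction to `ℓ²(ℕ)` of an operator on sequences that contracts the `ℓ²` norm. -/
def contraction (T : (ℕ → ℂ) →ₗ[ℂ] (ℕ → ℂ))
    (hT : ∀ ψ : lp (fun _ : ℕ => ℂ) 2,
      Summable (fun n => ‖T ψ n‖ ^ 2) ∧ ∑' n, ‖T ψ n‖ ^ 2 ≤ ∑' n, ‖ψ n‖ ^ 2) :
    Cavity →L[ℂ] Cavity :=
  LinearMap.mkContinuous
    { toFun := fun ψ => fockBasis.repr.symm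
        ⟨T (fockBasis.repr ψ), memℓp_of_summable (hT (fockBasis.repr ψ)).1⟩
      map_add' := fun ψ φ => by
        rw [← map_add]
        congr 1
        ext n
        exact congrFun (map_add T _ _) n
      map_smul' := fun c ψ => by
        rw [RingHom.id_apply, ← map_smul]
        congr 1
        ext n
        rw [map_smul]
        exact congrFun (map_smul T _ _) n }
    1 (fun ψ => by
      rw [one_mul]
      change ‖fockBasis.repr.symm _‖ ≤ _
      rw [LinearIsometryEquiv.norm_map, ← fockBasis.repr.norm_map ψ]
      refine le_of_sq_le_sq ?_ (norm_nonneg _)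
      rw [norm_sq_coord, norm_sq_coord]
      exact (hT (fockBasis.repr ψ)).2)

/-- The Kraus operators `V_{σσ'}`. -/
def Params.V (m : Params) (y : Outcome) : Cavity →L[ℂ] Cavity :=
  contraction (m.krausSeq y) (krausSeq_summable m y)

theorem gibbs_summable (m : Params) (ψ : lp (fun _ : ℕ => ℂ) 2) :
    Summable (fun n => ‖numberFun (fun n => ((Real.exp (-m.β * m.ε * n) /
      ∑' k : ℕ, Real.exp (-m.β * m.ε * k) : ℝ) : ℂ)) ψ n‖ ^ 2) ∧
      ∑' n, ‖numberFun (fun n => ((Real.exp (-m.β * m.ε * n) /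
        ∑' k : ℕ, Real.exp (-m.β * m.ε * k) : ℝ) : ℂ)) ψ n‖ ^ 2 ≤ ∑' n, ‖ψ n‖ ^ 2 := by
  have hs := summable_coord ψ
  have hle : ∀ n, ‖numberFun (fun n => ((Real.exp (-m.β * m.ε * n) /
      ∑' k : ℕ, Real.exp (-m.β * m.ε * k) : ℝ) : ℂ)) ψ n‖ ^ 2 ≤ ‖ψ n‖ ^ 2 := fun n => by
    have h1 : Real.exp (-m.β * m.ε * n) / ∑' k : ℕ, Real.exp (-m.β * m.ε * k) ≤ 1 := by
      by_cases h : Summable fun k : ℕ => Real.exp (-m.β * m.ε * k)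
      · exact div_le_one_of_le₀ (h.le_tsum n fun _ _ => (Real.exp_pos _).le)
          (tsum_nonneg fun _ => (Real.exp_pos _).le)
      · rw [tsum_eq_zero_of_not_summable h, div_zero]
        exact zero_le_one
    have h0 : 0 ≤ Real.exp (-m.β * m.ε * n) / ∑' k : ℕ, Real.exp (-m.β * m.ε * k) :=
      div_nonneg (Real.exp_pos _).le (tsum_nonneg fun _ => (Real.exp_pos _).le)
    change ‖((_ : ℝ) : ℂ) * ψ n‖ ^ 2 ≤ _
    rw [norm_mul, mul_pow, Complex.norm_real, Real.norm_eq_abs, abs_of_nonneg h0]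
    exact mul_le_of_le_one_left (by positivity) (pow_le_one₀ h0 h1)
  have := Summable.of_nonneg_of_le (fun n => by positivity) hle hs
  exact ⟨this, this.tsum_le_tsum hle hs⟩

/-- The Gibbs state `ρ_inv = e^{-βεN} / Tr e^{-βεN}` (meaningful for `βε > 0`). -/
def Params.gibbs (m : Params) : Cavity →L[ℂ] Cavity :=
  contraction (numberFun fun n => ((Real.exp (-m.β * m.ε * n) /
    ∑' k : ℕ, Real.exp (-m.β * m.ε * k) : ℝ) : ℂ)) (gibbs_summable m)

/-! ### The quantum trajectory -/

/-- Sequences of outcomes; `ω t` is the outcome of the `(t+1)`-st measurement. The measurable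
structure is the product one, generated by the cylinders. -/
abbrev Ω : Type := ℕ → Outcome

/-- `W_t(ω) = V_{ω_t} ⋯ V_{ω_1}`, the outcomes being numbered from `1` here. -/
def Params.W (m : Params) (ω : Ω) : ℕ → (Cavity →L[ℂ] Cavity)
  | 0 => 1
  | t + 1 => m.V (ω t) * m.W ω t

/-- `W_t(ω) ρ W_t(ω)*`. -/
def Params.unnormalized (m : Params) (ρ : Cavity →L[ℂ] Cavity) (t : ℕ) (ω : Ω) :
    Cavity →L[ℂ] Cavity :=
  m.W ω t * ρ * star (m.W ω t)

/-- The quantum trajectory `ρ_t = W_t ρ W_t* / Tr(W_t ρ W_t*)`. -/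
def Params.trajectory (m : Params) (ρ : Cavity →L[ℂ] Cavity) (t : ℕ) (ω : Ω) :
    Cavity →L[ℂ] Cavity :=
  (trace (m.unnormalized ρ t ω))⁻¹ • m.unnormalized ρ t ω

/-- `P` is the law of the outcomes for the initial state `ρ`: each elementary cylinder determined
by the first `t` outcomes of `ω` has probability `Tr(W_t(ω) ρ W_t(ω)*)`. -/
structure IsOutcomeLaw (m : Params) (ρ : Cavity →L[ℂ] Cavity) (P : Measure Ω) : Prop where
  isProbabilityMeasure : IsProbabilityMeasure P
  cylinder : ∀ (t : ℕ) (ω : Ω),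
    P {ω' | ∀ i < t, ω' i = ω i} = ENNReal.ofReal (trace (m.unnormalized ρ t ω)).re

/-- A consistent family of probabilities of finite words is realised by a measure. -/
theorem exists_measure_of_weights (p : ℕ → Ω → ℝ≥0∞)
    (hdep : ∀ n ω ω', (∀ i < n, ω i = ω' i) → p n ω = p n ω')
    (h0 : ∀ ω, p 0 ω = 1)
    (hs : ∀ n ω, ∑ y, p (n + 1) (Function.update ω n y) = p n ω) :
    ∃ P : Measure Ω, IsProbabilityMeasure P ∧
      ∀ n ω, P {ω' | ∀ i < n, ω' i = ω i} = p n ω := by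
  classical
  have hle : ∀ n ω, p n ω ≤ 1 := by
    intro n
    induction n with
    | zero => exact fun ω => (h0 ω).le
    | succ n ih =>
      intro ω
      have h1 : p (n + 1) (Function.update ω n (ω n)) ≤ p n ω := by
        rw [← hs n ω]
        exact Finset.single_le_sum (f := fun y => p (n + 1) (Function.update ω n y))
          (fun _ _ => zero_le) (Finset.mem_univ _)
      rw [Function.update_eq_self] at h1
      exact h1.trans (ih ω)
  have htop : ∀ n ω, p n ω ≠ ∞ := fun n ω => ((hle n ω).trans_lt ENNReal.one_lt_top).ne
  let c : ℕ → Ω → Measure Outcome := fun n w =>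
    if p n w = 0 then Measure.dirac default
    else ∑ y, (p (n + 1) (Function.update w n y) / p n w) • Measure.dirac y
  have hc : ∀ n w, IsProbabilityMeasure (c n w) := fun n w => by
    by_cases h : p n w = 0
    · simp only [c, h, if_true]; infer_instance
    · refine ⟨?_⟩
      simp only [c, h, if_false, Measure.coe_finsetSum, Finset.sum_apply, Measure.smul_apply,
        measure_univ, smul_eq_mul, mul_one, div_eq_mul_inv]
      rw [← Finset.sum_mul, hs, ENNReal.mul_inv_cancel h (htop n w)]
  have hcy : ∀ n w y, p n w * c n w {y} = p (n + 1) (Function.update w n y) := fun n w y => by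
    by_cases h : p n w = 0
    · rw [h, zero_mul]
      have h1 := hs n w
      rw [h, Finset.sum_eq_zero_iff] at h1
      exact (h1 y (Finset.mem_univ _)).symm
    · simp only [c, h, if_false, Measure.coe_finsetSum, Finset.sum_apply, Measure.smul_apply,
        smul_eq_mul]
      rw [Finset.sum_eq_single y]
      · simp [ENNReal.mul_div_cancel h (htop n w)]
      · intro b _ hb
        simp [hb]
      · simp
  let wd : (n : ℕ) → ((Finset.Iic n) → Outcome) → Ω := fun n x i =>
    if h : i + 1 ≤ n then x ⟨i + 1, Finset.mem_Iic.2 h⟩ else default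
  let κ : (n : ℕ) → ProbabilityTheory.Kernel ((Finset.Iic n) → Outcome) Outcome := fun n =>
    ProbabilityTheory.Kernel.ofFunOfCountable fun x => c n (wd n x)
  have hκ : ∀ n, ProbabilityTheory.IsMarkovKernel (κ n) := fun n => ⟨fun x => hc n (wd n x)⟩
  let Q : Measure Ω :=
    ProbabilityTheory.Kernel.trajMeasure (X := fun _ => Outcome) (Measure.dirac default) κ
  have hQ : IsProbabilityMeasure Q :=
    inferInstanceAs (IsProbabilityMeasure (ProbabilityTheory.Kernel.trajMeasure
      (X := fun _ => Outcome) (Measure.dirac default) κ))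
  have hm : Measurable (fun (ω : Ω) (i : ℕ) => ω (i + 1)) := by fun_prop
  have key : ∀ n ω, Q {ω' | ∀ i < n, ω' (i + 1) = ω i} = p n ω := by
    intro n
    induction n with
    | zero => intro ω; simp [h0]
    | succ n ih =>
      intro ω
      have hcomp := ProbabilityTheory.Kernel.map_frestrictLe_trajMeasure_compProd_eq_map_trajMeasure
        (X := fun _ => Outcome) (κ := κ) (μ₀ := Measure.dirac default) (a := n)
      let A : Set ((Finset.Iic n) → Outcome) := {x | ∀ i < n, wd n x i = ω i}
      have hA : MeasurableSet A := Set.Finite.measurableSet (Set.toFinite A)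
      have h1 := DFunLike.congr_fun hcomp (A ×ˢ {ω n})
      rw [Measure.compProd_apply_prod hA (measurableSet_singleton _),
        Measure.map_apply (by fun_prop) (hA.prod (measurableSet_singleton _))] at h1
      have h2 : ∀ x ∈ A, κ n x {ω n} = c n ω {ω n} := fun x hx => by
        have e1 : p n (wd n x) = p n ω := hdep n _ _ hx
        have e2 : ∀ y, p (n + 1) (Function.update (wd n x) n y)
            = p (n + 1) (Function.update ω n y) := fun y => hdep _ _ _ fun i hi => by
          rcases Nat.lt_succ_iff_lt_or_eq.1 hi with h | rfl
          · rw [Function.update_of_ne h.ne, Function.update_of_ne h.ne, hx i h]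
          · simp
        change c n (wd n x) {ω n} = c n ω {ω n}
        simp only [c, e1, e2]
      rw [setLIntegral_congr_fun hA h2, setLIntegral_const,
        Measure.map_apply (by fun_prop) hA] at h1
      have e3 : Preorder.frestrictLe n ⁻¹' A = {ω' : Ω | ∀ i < n, ω' (i + 1) = ω i} := by
        ext ω'
        simp only [A, wd, Set.mem_preimage, Set.mem_ofPred_eq]
        refine forall_congr' fun i => forall_congr' fun hi => ?_
        rw [dif_pos (Nat.succ_le_of_lt hi)]
        rfl
      have e4 : (fun x : Ω => (Preorder.frestrictLe (π := fun _ => Outcome) n x, x (n + 1))) ⁻¹'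
          (A ×ˢ {ω n}) = {ω' : Ω | ∀ i < n + 1, ω' (i + 1) = ω i} := by
        ext ω'
        have := Set.ext_iff.1 e3 ω'
        simp only [Set.mem_preimage, Set.mem_prod, Set.mem_singleton_iff, Set.mem_ofPred_eq]
          at this ⊢
        rw [this]
        constructor
        · rintro ⟨a, b⟩ i hi
          rcases Nat.lt_succ_iff_lt_or_eq.1 hi with h | rfl
          · exact a i h
          · exact b
        · exact fun h => ⟨fun i hi => h i (by omega), h n (by omega)⟩
      rw [e3, e4] at h1
      change _ * Q _ = Q _ at h1
      rw [ih, mul_comm, hcy, Function.update_eq_self] at h1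
      exact h1.symm
  refine ⟨Q.map fun ω i => ω (i + 1), Measure.isProbabilityMeasure_map hm.aemeasurable,
    fun n ω => ?_⟩
  rw [Measure.map_apply hm, ← key n ω]
  · rfl
  · have : {ω' : Ω | ∀ i < n, ω' i = ω i} = ⋂ i, ⋂ (_ : i < n), {ω' : Ω | ω' i = ω i} := by
      ext; simp
    rw [this]
    exact MeasurableSet.iInter fun i => MeasurableSet.iInter fun _ =>
      measurableSet_eq_fun (measurable_pi_apply i) measurable_const

theorem inner_fock (n : ℕ) (ψ : Cavity) : inner ℂ (fock n) ψ = fockBasis.repr ψ n :=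
  (fockBasis.repr_apply_apply ψ n).symm

theorem repr_V (m : Params) (y : Outcome) (ψ : Cavity) (n : ℕ) :
    fockBasis.repr (m.V y ψ) n = m.amp y n * fockBasis.repr ψ (src y n) :=
  krausSeq_apply m y _ n

theorem star_V_fock (m : Params) (y : Outcome) (n : ℕ) :
    star (m.V y) (fock n) = (starRingEnd ℂ) (m.amp y n) • fock (src y n) := by
  refine ext_inner_right ℂ fun ψ => ?_
  rw [ContinuousLinearMap.star_eq_adjoint, ContinuousLinearMap.adjoint_inner_left, inner_smul_left,
    inner_fock, inner_fock, repr_V, Complex.conj_conj]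

/-- The diagonal of an operator in the Fock basis. -/
def diag (X : Cavity →L[ℂ] Cavity) (k : ℕ) : ℝ := (inner ℂ (fock k) (X (fock k))).re

theorem diag_conj (m : Params) (X : Cavity →L[ℂ] Cavity) (y : Outcome) (n : ℕ) :
    diag (m.V y * X * star (m.V y)) n = ‖m.amp y n‖ ^ 2 * diag X (src y n) := by
  have h : inner ℂ (fock n) ((m.V y * X * star (m.V y)) (fock n))
      = inner ℂ (star (m.V y) (fock n)) (X (star (m.V y) (fock n))) := by
    rw [ContinuousLinearMap.star_eq_adjoint, ContinuousLinearMap.adjoint_inner_left]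
    rfl
  rw [diag, h, star_V_fock, map_smul, inner_smul_left, inner_smul_right, Complex.conj_conj,
    ← mul_assoc, Complex.mul_conj, Complex.normSq_eq_norm_sq, Complex.re_ofReal_mul, diag]

theorem tsum_diag_conj (m : Params) (X : Cavity →L[ℂ] Cavity) :
    ∑ y, ∑' n, ENNReal.ofReal (diag (m.V y * X * star (m.V y)) n)
      = ∑' n, ENNReal.ofReal (diag X n) := by
  have e1 : ∑' n, ENNReal.ofReal (diag (m.V (true, true) * X * star (m.V (true, true))) n)
      = ∑' n, ENNReal.ofReal (m.pAt true * ‖m.C (n + 1)‖ ^ 2 * diag X n) :=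
    tsum_congr fun n => by rw [diag_conj, m.norm_amp_sq, src]
  have e2 : ∑' n, ENNReal.ofReal (diag (m.V (true, false) * X * star (m.V (true, false))) n)
      = ∑' n : ℕ, ENNReal.ofReal (m.pAt true * (m.S (n + 1) ^ 2 * ((n + 1 : ℕ) : ℝ)) *
        diag X n) := by
    have h0 : diag (m.V (true, false) * X * star (m.V (true, false))) 0 = 0 := by
      rw [diag_conj, m.norm_amp_sq]
      simp
    have hn : ∀ n, diag (m.V (true, false) * X * star (m.V (true, false))) (n + 1)
        = m.pAt true * (m.S (n + 1) ^ 2 * ((n + 1 : ℕ) : ℝ)) * diag X n := fun n => by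
      rw [diag_conj, m.norm_amp_sq, src, Nat.add_sub_cancel]
    generalize diag (m.V (true, false) * X * star (m.V (true, false))) = f at h0 hn
    rw [tsum_eq_zero_add' (f := fun n => ENNReal.ofReal (f n)) ENNReal.summable, h0]
    simp only [hn, ENNReal.ofReal_zero, zero_add]
  have e3 : ∑' n, ENNReal.ofReal (diag (m.V (false, true) * X * star (m.V (false, true))) n)
      = ∑' n : ℕ, ENNReal.ofReal (m.pAt false * (m.S n ^ 2 * (n : ℝ)) * diag X n) := by
    rw [tsum_eq_zero_add'
      (f := fun n : ℕ => ENNReal.ofReal (m.pAt false * (m.S n ^ 2 * (n : ℝ)) * diag X n))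
      ENNReal.summable]
    simp only [Nat.cast_zero, mul_zero, zero_mul, ENNReal.ofReal_zero, zero_add]
    exact tsum_congr fun n => by rw [diag_conj, m.norm_amp_sq, src]
  have e4 : ∑' n, ENNReal.ofReal (diag (m.V (false, false) * X * star (m.V (false, false))) n)
      = ∑' n, ENNReal.ofReal (m.pAt false * ‖m.C n‖ ^ 2 * diag X n) :=
    tsum_congr fun n => by rw [diag_conj, m.norm_amp_sq, src]
  rw [Fintype.sum_prod_type, Fintype.sum_bool, Fintype.sum_bool, Fintype.sum_bool, e1, e2, e3, e4,
    ← ENNReal.tsum_add, ← ENNReal.tsum_add, ← ENNReal.tsum_add]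
  refine tsum_congr fun n => ?_
  have h1 := m.pAt_nonneg false
  have h2 := m.pAt_nonneg true
  have h3 := m.pAt_add
  have h4 := m.C_S n
  have h5 := m.C_S (n + 1)
  have hA : 0 ≤ m.pAt true * ‖m.C (n + 1)‖ ^ 2 := by positivity
  have hB : 0 ≤ m.pAt true * (m.S (n + 1) ^ 2 * ((n + 1 : ℕ) : ℝ)) := by positivity
  have hC : 0 ≤ m.pAt false * (m.S n ^ 2 * (n : ℝ)) := by positivity
  have hD : 0 ≤ m.pAt false * ‖m.C n‖ ^ 2 := by positivity
  rw [ENNReal.ofReal_mul hA, ENNReal.ofReal_mul hB, ENNReal.ofReal_mul hC, ENNReal.ofReal_mul hD,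
    ← add_mul, ← add_mul, ← add_mul, ← ENNReal.ofReal_add hA hB, ← ENNReal.ofReal_add hC hD,
    ← ENNReal.ofReal_add (add_nonneg hA hB) (add_nonneg hC hD),
    show m.pAt true * ‖m.C (n + 1)‖ ^ 2 + m.pAt true * (m.S (n + 1) ^ 2 * ((n + 1 : ℕ) : ℝ)) +
      (m.pAt false * (m.S n ^ 2 * (n : ℝ)) + m.pAt false * ‖m.C n‖ ^ 2) = 1 by
        linear_combination m.pAt true * h5 + m.pAt false * h4 + h3]
  simp

theorem ofReal_trace (X : Cavity →L[ℂ] Cavity) (hX : X.IsPositive)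
    (h : ∑' n, ENNReal.ofReal (diag X n) ≠ ∞) :
    ENNReal.ofReal (trace X).re = ∑' n, ENNReal.ofReal (diag X n) := by
  have h0 : ∀ n, 0 ≤ diag X n := fun n => hX.re_inner_nonneg_right (fock n)
  have hs : Summable (diag X) := by
    have := ENNReal.summable_toReal h
    simpa [ENNReal.toReal_ofReal (h0 _)] using this
  have hz : ∀ n, inner ℂ (fock n) (X (fock n)) = ((diag X n : ℝ) : ℂ) := fun n => by
    have := hX.inner_nonneg_right (fock n)
    exact Complex.eq_re_of_ofReal_le this
  have : trace X = ((∑' n, diag X n : ℝ) : ℂ) := by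
    rw [trace, Complex.ofReal_tsum]
    exact tsum_congr hz
  rw [this, Complex.ofReal_re, ENNReal.ofReal_tsum_of_nonneg h0 hs]

theorem W_congr (m : Params) (t : ℕ) (ω ω' : Ω) (h : ∀ i < t, ω i = ω' i) :
    m.W ω t = m.W ω' t := by
  induction t with
  | zero => rfl
  | succ t ih => rw [Params.W, Params.W, ih fun i hi => h i (by omega), h t (by omega)]

theorem unnormalized_succ (m : Params) (ρ : Cavity →L[ℂ] Cavity) (t : ℕ) (ω : Ω) :
    m.unnormalized ρ (t + 1) ω = m.V (ω t) * m.unnormalized ρ t ω * star (m.V (ω t)) := by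
  simp only [Params.unnormalized, Params.W, star_mul, mul_assoc]

theorem exists_outcomeLaw (m : Params) {ρ : Cavity →L[ℂ] Cavity} (hρ : IsState ρ) :
    ∃ P : Measure Ω, IsOutcomeLaw m ρ P := by
  have hpos : ∀ t ω, (m.unnormalized ρ t ω).IsPositive := fun t ω =>
    hρ.isPositive.conj_adjoint (m.W ω t)
  have hfin0 : ∑' n, ENNReal.ofReal (diag ρ n) ≠ ∞ := by
    have h := hρ.traceClass
    rw [traceNorm, CFC.abs_of_nonneg ρ
      ((ContinuousLinearMap.nonneg_iff_isPositive ρ).2 hρ.isPositive)] at h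
    exact h.ne
  have h0 : ∀ ω, m.unnormalized ρ 0 ω = ρ := fun ω => by
    simp [Params.unnormalized, Params.W]
  have hone : ∑' n, ENNReal.ofReal (diag ρ n) = 1 := by
    rw [← ofReal_trace ρ hρ.isPositive hfin0, hρ.trace_eq_one]
    simp
  have hstep : ∀ t ω, ∑ y, ∑' n, ENNReal.ofReal
      (diag (m.unnormalized ρ (t + 1) (Function.update ω t y)) n)
        = ∑' n, ENNReal.ofReal (diag (m.unnormalized ρ t ω) n) := fun t ω => by
    rw [← tsum_diag_conj m]
    refine Finset.sum_congr rfl fun y _ => ?_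
    have : m.unnormalized ρ t (Function.update ω t y) = m.unnormalized ρ t ω := by
      rw [Params.unnormalized, Params.unnormalized, W_congr m t (Function.update ω t y) ω
        fun i hi => Function.update_of_ne hi.ne _ _]
    rw [unnormalized_succ, this, Function.update_self]
  obtain ⟨P, hP, hcyl⟩ := exists_measure_of_weights
    (fun t ω => ∑' n, ENNReal.ofReal (diag (m.unnormalized ρ t ω) n))
    (fun t ω ω' h => by simp only [Params.unnormalized, W_congr m t ω ω' h])
    (fun ω => by rw [h0, hone]) hstep
  refine ⟨P, hP, fun t ω => ?_⟩
  rw [hcyl, ofReal_trace _ (hpos t ω)]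
  rw [← hcyl]
  exact measure_ne_top P _

open Classical in
/-- The law `ℙ^ρ` of the sequence of outcomes when the initial state is `ρ` (junk value `0` when
`ρ` is not a state). -/
def Params.law (m : Params) (ρ : Cavity →L[ℂ] Cavity) : Measure Ω :=
  if h : IsState ρ then Classical.choose (exists_outcomeLaw m h) else 0

theorem isOutcomeLaw_law (m : Params) {ρ : Cavity →L[ℂ] Cavity} (hρ : IsState ρ) :
    IsOutcomeLaw m ρ (m.law ρ) := by
  rw [Params.law, dif_pos hρ]
  exact Classical.choose_spec (exists_outcomeLaw m hρ)

theorem repr_gibbs (m : Params) (ψ : Cavity) (n : ℕ) :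
    fockBasis.repr (m.gibbs ψ) n = ((Real.exp (-m.β * m.ε * n) /
      ∑' k : ℕ, Real.exp (-m.β * m.ε * k) : ℝ) : ℂ) * fockBasis.repr ψ n :=
  rfl

/-- `ρ_inv` is a state when `βε > 0`. -/
theorem isState_gibbs (m : Params) (h : 0 < m.β * m.ε) : IsState m.gibbs := by
  have hw : ∀ n : ℕ, 0 ≤ Real.exp (-m.β * m.ε * n) / ∑' k : ℕ, Real.exp (-m.β * m.ε * k) :=
    fun n => div_nonneg (Real.exp_pos _).le (tsum_nonneg fun _ => (Real.exp_pos _).le)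
  have hs : Summable fun k : ℕ => Real.exp (-m.β * m.ε * k) := by
    have := Real.summable_exp_nat_mul_iff.2 (show -m.β * m.ε < 0 by nlinarith)
    simpa [mul_comm] using this
  have hZ : ∑' k : ℕ, Real.exp (-m.β * m.ε * k) ≠ 0 :=
    (hs.tsum_pos (fun _ => (Real.exp_pos _).le) 0 (Real.exp_pos _)).ne'
  have hsum : HasSum (fun n : ℕ => Real.exp (-m.β * m.ε * n) /
      ∑' k : ℕ, Real.exp (-m.β * m.ε * k)) 1 := by
    have := hs.hasSum.div_const (∑' k : ℕ, Real.exp (-m.β * m.ε * k))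
    rwa [div_self hZ] at this
  have hd : ∀ n, inner ℂ (fock n) (m.gibbs (fock n)) = ((Real.exp (-m.β * m.ε * n) /
      ∑' k : ℕ, Real.exp (-m.β * m.ε * k) : ℝ) : ℂ) := fun n => by
    rw [inner_fock, repr_gibbs, ← inner_fock, fock, inner_self_eq_norm_sq_to_K,
      fockBasis.orthonormal.1 n]
    simp
  have hpos : m.gibbs.IsPositive := by
    rw [ContinuousLinearMap.isPositive_iff_complex]
    intro ψ
    have h1 : HasSum (fun n : ℕ => ((Real.exp (-m.β * m.ε * n) /
        (∑' k : ℕ, Real.exp (-m.β * m.ε * k)) * ‖fockBasis.repr ψ n‖ ^ 2 : ℝ) : ℂ))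
        (inner ℂ (m.gibbs ψ) ψ) := by
      rw [← fockBasis.repr.inner_map_map]
      have h := (lp.hasSum_inner (𝕜 := ℂ) (fockBasis.repr (m.gibbs ψ))
        (fockBasis.repr ψ))
      have e : ∀ n, inner ℂ (fockBasis.repr (m.gibbs ψ) n) (fockBasis.repr ψ n) =
          ((Real.exp (-m.β * m.ε * n) / (∑' k : ℕ, Real.exp (-m.β * m.ε * k)) *
            ‖fockBasis.repr ψ n‖ ^ 2 : ℝ) : ℂ) := fun n => by
        rw [repr_gibbs, RCLike.inner_apply, map_mul, Complex.conj_ofReal, mul_left_comm,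
          Complex.mul_conj, Complex.normSq_eq_norm_sq, ← Complex.ofReal_mul]
      rw [← funext e]
      exact h
    have h2 := Complex.hasSum_re h1
    have h3 := Complex.hasSum_im h1
    simp only [Complex.ofReal_re, Complex.ofReal_im] at h2 h3
    refine ⟨Complex.ext (by simp) (by simpa using h3.unique hasSum_zero |>.symm), ?_⟩
    exact h2.nonneg fun n => mul_nonneg (hw n) (sq_nonneg _)
  refine ⟨hpos, ?_, ?_⟩
  · rw [traceNorm, CFC.abs_of_nonneg _ ((ContinuousLinearMap.nonneg_iff_isPositive _).2 hpos)]
    simp only [hd, Complex.ofReal_re]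
    rw [← ENNReal.ofReal_tsum_of_nonneg hw hsum.summable]
    exact ENNReal.ofReal_lt_top
  · rw [trace]
    simp only [hd]
    rw [← Complex.ofReal_tsum, hsum.tsum_eq, Complex.ofReal_one]

/-! ### Evolved Fock states -/

/-- The one-step shift: `1` for `(+,-)`, `-1` for `(-,+)`, `0` otherwise. -/
def δ : Outcome → ℤ
  | (true, false) => 1
  | (false, true) => -1
  | _ => 0

/-- The total shift `s_t(ω) = ∑_{u ≤ t} δ(ω_u)`. -/
def shift (t : ℕ) (ω : Ω) : ℤ := ∑ u ∈ Finset.range t, δ (ω u)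

/-- The extinction time `τ^k(ω) = inf {t ≥ 1 : W_t(ω)|k⟩ = 0}`, equal to `∞` if there is no
such `t`. -/
def Params.extinctionTime (m : Params) (k : ℕ) (ω : Ω) : ℕ∞ :=
  ⨅ (t : ℕ) (_ : 1 ≤ t ∧ m.W ω t (fock k) = 0), (t : ℕ∞)

open Classical in
/-- The evolved Fock label: `N_t(k,ω) = k + s_t(ω)` if `t < τ^k(ω)`, and the cemetery value `-1`
otherwise. -/
def Params.evolved (m : Params) (t k : ℕ) (ω : Ω) : ℤ :=
  if (t : ℕ∞) < m.extinctionTime k ω then k + shift t ω else -1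

/-- The vector `|z⟩`: a Fock vector for `z ≥ 0`, and the chosen cemetery vector `c` for
`z = -1`. -/
def ket (c : Cavity) (z : ℤ) : Cavity := if 0 ≤ z then fock z.toNat else c

/-- The distance `‖ρ_t - |N_t(n_∞,·)⟩⟨N_t(n_∞,·)|‖₁`, as a function of `ω`. -/
def Params.dist (m : Params) (c : Cavity) (ρ : Cavity →L[ℂ] Cavity) (nInf : Ω → ℕ) (t : ℕ)
    (ω : Ω) : ℝ≥0∞ :=
  traceNorm (m.trajectory ρ t ω - ketBra (ket c (m.evolved t (nInf ω) ω)))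

end Maser

end

noncomputable section

namespace Maser

/-! ### Cylinders of the space of outcomes -/

/-! Every Kraus operator sends a Fock vector to a multiple of a Fock vector, so `W_t|k⟩` is a
multiple of `|k + s_t⟩`, and the diagonal of `W_t ρ W_t*` depends only on the diagonal of `ρ`. Hence
the law of the outcomes is the mixture, with weights `⟨k, ρ k⟩`, of the laws for the initial states
`|k⟩⟨k|` (`law_eq_sum`).

Under the `k`-th Fock law, `k + s_t` is a birth-death chain that goes up from `n` with probability
`p_at(+) r(n+1)` and down with probability `p_at(-) r(n)`, where `r(n) = S(n)² n`. Without Rabi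
resonance `r(n) > 0` for `n > 0`, and `β > 0` gives `p_at(+) < p_at(-)`, so the chain reaches `0`
almost surely (`fockLaw_neverEmpty`). A label `l < k` that survives forever would force `l + s_t ≥
0`, hence `k + s_t ≥ 1`, for all `t`: a null event. The label `k` itself survives almost surely. So
the least surviving label, taken as `n_∞`, equals `k` almost surely under the `k`-th law
(`ae_fockLaw_initialLabel`). The Fock laws are therefore mutually singular, and `n_∞` reads off the
component of the mixture; this gives its law and the absence of extinction.

For purification, the conditional probability of `n_∞ = k` given `t` outcomes is exactly `⟨k + s_t,
ρ_t (k + s_t)⟩`. By Lévy's zero-one law (`tendsto_measure_cyl_ratio`) it tends to `1` almost surely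
on `n_∞ = k`. A state whose mean value `F` at a unit vector `φ` is near `1` is close to `|φ⟩⟨φ|` in
trace norm, at distance at most `6 √(1 - F)` (`traceNorm_sub_ketBra_le`). The same bound dominates
the distance by `6`, so convergence in `L¹` follows by dominated convergence. -/

/-- The set of the sequences of outcomes that agree with `ω` in the first `t` steps. -/
def cyl (t : ℕ) (ω : Ω) : Set Ω := {ω' | ∀ i < t, ω' i = ω i}

/-- The first `t` outcomes. -/
def firstOutcomes (t : ℕ) (ω : Ω) : Fin t → Outcome := fun i => ω i

/-- A sequence of outcomes that starts with a given word. -/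
def extendWord {t : ℕ} (w : Fin t → Outcome) : Ω :=
  fun i => if h : i < t then w ⟨i, h⟩ else default

theorem extendWord_firstOutcomes {t : ℕ} {ω : Ω} {i : ℕ} (hi : i < t) :
    extendWord (firstOutcomes t ω) i = ω i := by
  simp [extendWord, firstOutcomes, hi]

theorem measurable_firstOutcomes (t : ℕ) : Measurable (firstOutcomes t) := by
  unfold firstOutcomes
  fun_prop

theorem preimage_firstOutcomes_singleton {t : ℕ} (w : Fin t → Outcome) :
    firstOutcomes t ⁻¹' {w} = cyl t (extendWord w) := by
  ext ω
  simp only [Set.mem_preimage, Set.mem_singleton_iff, cyl, Set.mem_ofPred_eq, funext_iff]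
  constructor
  · intro h i hi
    simpa [extendWord, hi, firstOutcomes] using h ⟨i, hi⟩
  · intro h i
    simpa [extendWord, firstOutcomes] using h i i.2

theorem cyl_congr {t : ℕ} {ω ω' : Ω} (h : ∀ i < t, ω i = ω' i) : cyl t ω = cyl t ω' := by
  ext x
  simp only [cyl, Set.mem_ofPred_eq]
  exact forall₂_congr fun i hi => by rw [h i hi]

theorem cyl_zero (ω : Ω) : cyl 0 ω = Set.univ := by
  simp [cyl]

theorem mem_cyl_self (t : ℕ) (ω : Ω) : ω ∈ cyl t ω := fun _ _ => rfl

/-- Such a function factors through the finite set of words of length `t`, on which every function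
is measurable. -/
theorem measurable_of_dependsOn {β : Type*} [MeasurableSpace β] {t : ℕ} {f : Ω → β}
    (h : ∀ ω ω', (∀ i < t, ω i = ω' i) → f ω = f ω') : Measurable f := by
  have : f = (fun w => f (extendWord w)) ∘ firstOutcomes t := by
    ext1 ω
    exact h _ _ fun i hi => (extendWord_firstOutcomes hi).symm
  rw [this]
  exact (measurable_of_countable _).comp (measurable_firstOutcomes t)

theorem measurableSet_cyl (t : ℕ) (ω : Ω) : MeasurableSet (cyl t ω) := by
  have : cyl t ω = firstOutcomes t ⁻¹' {firstOutcomes t ω} := by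
    rw [preimage_firstOutcomes_singleton]
    exact cyl_congr fun i hi => (extendWord_firstOutcomes hi).symm
  rw [this]
  exact measurable_firstOutcomes t (measurableSet_singleton _)

/-- There are finitely many cylinders of length `t`, so the union of the null ones is null. No
measurability of `p` is needed. -/
theorem measure_setOf_eq_zero {μ : Measure Ω} {t : ℕ} {p : Ω → Prop}
    (h : ∀ ω, p ω → μ (cyl t ω) = 0) : μ {ω | p ω} = 0 := by
  classical
  have hsub : {ω | p ω} ⊆ ⋃ w ∈ {w : Fin t → Outcome | μ (cyl t (extendWord w)) = 0},
      cyl t (extendWord w) := by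
    intro ω hω
    have e : cyl t (extendWord (firstOutcomes t ω)) = cyl t ω :=
      cyl_congr fun i hi => extendWord_firstOutcomes hi
    refine Set.mem_biUnion (x := firstOutcomes t ω) ?_ ?_
    · change μ _ = 0
      rw [e]
      exact h ω hω
    · rw [e]
      exact mem_cyl_self t ω
  refine measure_mono_null hsub ?_
  exact (measure_biUnion_null_iff (Set.to_countable _)).2 fun w hw => hw

/-- The filtration generated by the outcomes. -/
def outcomeFiltration : Filtration ℕ (inferInstance : MeasurableSpace Ω) where
  seq t := MeasurableSpace.comap (firstOutcomes t) inferInstance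
  mono' s t hst := by
    rw [MeasurableSpace.comap_le_iff_le_map]
    intro A _
    refine ⟨(fun w : Fin t → Outcome => fun i : Fin s => w ⟨i, i.2.trans_le hst⟩) ⁻¹' A,
      (measurable_of_countable _) (Set.Finite.measurableSet (Set.toFinite A)), rfl⟩
  le' t := (measurable_firstOutcomes t).comap_le

theorem iSup_outcomeFiltration : ⨆ t, outcomeFiltration t = (inferInstance : MeasurableSpace Ω) := by
  refine le_antisymm (iSup_le fun t => outcomeFiltration.le t) ?_
  refine iSup_le fun i => ?_
  refine le_trans ?_ (le_iSup _ (i + 1))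
  rw [MeasurableSpace.comap_le_iff_le_map]
  intro A hA
  exact ⟨(fun w : Fin (i + 1) → Outcome => w (Fin.last i)) ⁻¹' A,
    measurable_pi_apply _ hA, rfl⟩

theorem isPiSystem_cyl : IsPiSystem {s | ∃ t ω, s = cyl t ω} := by
  rintro _ ⟨t, ω, rfl⟩ _ ⟨s, ω', rfl⟩ ⟨x, hx, hx'⟩
  refine ⟨max t s, x, ?_⟩
  rw [cyl_congr (fun i hi => (hx i hi).symm), cyl_congr (fun i hi => (hx' i hi).symm)]
  ext y
  simp only [cyl, Set.mem_inter_iff, Set.mem_ofPred_eq, lt_max_iff]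
  exact ⟨fun h i hi => hi.elim (h.1 i) (h.2 i), fun h => ⟨fun i hi => h i (Or.inl hi),
    fun i hi => h i (Or.inr hi)⟩⟩

theorem generateFrom_cyl :
    (inferInstance : MeasurableSpace Ω) = MeasurableSpace.generateFrom {s | ∃ t ω, s = cyl t ω} := by
  refine le_antisymm ?_ (MeasurableSpace.generateFrom_le ?_)
  · rw [← iSup_outcomeFiltration]
    refine iSup_le fun t => ?_
    rintro _ ⟨A, -, rfl⟩
    rw [← Set.biUnion_preimage_singleton]
    refine MeasurableSet.biUnion (Set.to_countable A) fun w _ => ?_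
    rw [preimage_firstOutcomes_singleton]
    exact MeasurableSpace.measurableSet_generateFrom ⟨t, _, rfl⟩
  · rintro _ ⟨t, ω, rfl⟩
    exact measurableSet_cyl t ω

theorem ext_of_cyl {μ ν : Measure Ω} [IsFiniteMeasure μ]
    (h : ∀ t ω, μ (cyl t ω) = ν (cyl t ω)) : μ = ν := by
  refine ext_of_generate_finite _ generateFrom_cyl isPiSystem_cyl ?_ ?_
  · rintro _ ⟨t, ω, rfl⟩
    exact h t ω
  -- The cylinder of length `0` is the whole space, so the total masses agree.
  · simpa [cyl_zero] using h 0 default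

/-- Lévy's zero-one law along the cylinders. -/
theorem tendsto_measure_cyl_ratio (μ : Measure Ω) [IsFiniteMeasure μ] {A : Set Ω}
    (hA : MeasurableSet A) :
    ∀ᵐ ω ∂μ, Tendsto (fun t => μ.real (A ∩ cyl t ω) / μ.real (cyl t ω)) atTop
      (𝓝 (A.indicator 1 ω)) := by
  have hint : Integrable (A.indicator (1 : Ω → ℝ)) μ :=
    (integrable_const (1 : ℝ)).indicator hA
  -- The ratio is a version of the conditional probability of `A` given the first `t` outcomes.
  have hcond : ∀ t, (fun ω => μ.real (A ∩ cyl t ω) / μ.real (cyl t ω)) =ᵐ[μ]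
      μ[A.indicator (1 : Ω → ℝ) | outcomeFiltration t] := by
    intro t
    set g : (Fin t → Outcome) → ℝ := fun w =>
      μ.real (A ∩ cyl t (extendWord w)) / μ.real (cyl t (extendWord w)) with hg
    have hfg : (fun ω => μ.real (A ∩ cyl t ω) / μ.real (cyl t ω)) = g ∘ firstOutcomes t := by
      ext1 ω
      have e : cyl t (extendWord (firstOutcomes t ω)) = cyl t ω :=
        cyl_congr fun i hi => extendWord_firstOutcomes hi
      simp only [hg, Function.comp_apply, e]
    have hgi : Integrable g (μ.map (firstOutcomes t)) := Integrable.of_finite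
    have hfi : Integrable (g ∘ firstOutcomes t) μ :=
      hgi.comp_measurable (measurable_firstOutcomes t)
    rw [hfg]
    refine ae_eq_condExp_of_forall_setIntegral_eq (outcomeFiltration.le t) hint
      (fun _ _ _ => hfi.integrableOn) ?_ ?_
    · rintro _ ⟨B, hB, rfl⟩ -
      have hBm : MeasurableSet B := hB
      have h1 : ∫ x in firstOutcomes t ⁻¹' B, (g ∘ firstOutcomes t) x ∂μ
          = ∫ w in B, g w ∂(μ.map (firstOutcomes t)) :=
        (setIntegral_map hBm hgi.aestronglyMeasurable
          (measurable_firstOutcomes t).aemeasurable).symm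
      have h2 : ∫ x in firstOutcomes t ⁻¹' B, A.indicator (1 : Ω → ℝ) x ∂μ
          = ((μ.restrict A).map (firstOutcomes t)).real B := by
        rw [integral_indicator_one hA, measureReal_restrict_apply hA,
          map_measureReal_apply (measurable_firstOutcomes t) hBm,
          measureReal_restrict_apply (measurable_firstOutcomes t hBm), Set.inter_comm]
      rw [h1, h2, ← integral_indicator hBm, integral_fintype Integrable.of_finite]
      have h3 : ((μ.restrict A).map (firstOutcomes t)).real B
          = ∑ w, B.indicator (fun w => ((μ.restrict A).map (firstOutcomes t)).real {w}) w := by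
        classical
        rw [← Finset.sum_filter_add_sum_filter_not Finset.univ (· ∈ B),
          Finset.sum_congr rfl fun w hw => Set.indicator_of_mem (Finset.mem_filter.1 hw).2 _,
          Finset.sum_eq_zero (s := Finset.univ.filter (· ∉ B)) fun w hw =>
            Set.indicator_of_notMem (Finset.mem_filter.1 hw).2 _,
          sum_measureReal_singleton, add_zero, Finset.coe_filter_univ, Set.ofPred_mem_eq]
      rw [h3]
      refine Finset.sum_congr rfl fun w _ => ?_
      by_cases hw : w ∈ B
      · rw [Set.indicator_of_mem hw, Set.indicator_of_mem hw,
          map_measureReal_apply (measurable_firstOutcomes t) (measurableSet_singleton w),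
          map_measureReal_apply (measurable_firstOutcomes t) (measurableSet_singleton w),
          preimage_firstOutcomes_singleton, measureReal_restrict_apply (measurableSet_cyl _ _),
          smul_eq_mul, hg, Set.inter_comm _ A]
        -- On a null cylinder the ratio is `0 / 0 = 0`, which is harmless since the numerator
        -- vanishes too.
        refine mul_div_cancel_of_imp' fun h0 => ?_
        exact measureReal_mono_null Set.inter_subset_right h0
      · rw [Set.indicator_of_notMem hw, Set.indicator_of_notMem hw, smul_zero]
    · exact ⟨g ∘ firstOutcomes t, (measurable_of_countable g).stronglyMeasurable.comp_measurable
        (comap_measurable _), ae_eq_rfl⟩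
  have hlim := tendsto_ae_condExp (μ := μ) (ℱ := outcomeFiltration) (A.indicator (1 : Ω → ℝ))
  filter_upwards [hlim, ae_all_iff.2 hcond] with ω h1 h2
  have hself : μ[A.indicator (1 : Ω → ℝ) | ⨆ t, outcomeFiltration t] = A.indicator 1 := by
    rw [iSup_outcomeFiltration]
    exact condExp_of_stronglyMeasurable le_rfl
      (stronglyMeasurable_one.indicator hA) hint
  rw [hself] at h1
  exact h1.congr fun t => (h2 t).symm

/-! ### States close to a pure state in trace norm -/

theorem norm_fock (n : ℕ) : ‖fock n‖ = 1 := fockBasis.orthonormal.1 n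

theorem ketBra_apply (φ ψ : Cavity) : ketBra φ ψ = (inner ℂ φ ψ) • φ := by
  simp [ketBra]

theorem isPositive_ketBra (φ : Cavity) : (ketBra φ).IsPositive :=
  InnerProductSpace.isPositive_rankOne_self φ

theorem hasSum_norm_sq_coord (ψ : Cavity) :
    HasSum (fun n => ‖fockBasis.repr ψ n‖ ^ 2) (‖ψ‖ ^ 2) := by
  have := (summable_coord (fockBasis.repr ψ)).hasSum
  rwa [← norm_sq_coord, fockBasis.repr.norm_map] at this

theorem IsState.hasSum_diag {ρ : Cavity →L[ℂ] Cavity} (hρ : IsState ρ) :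
    HasSum (diag ρ) 1 := by
  have h0 : ∀ n, 0 ≤ diag ρ n := fun n => hρ.isPositive.re_inner_nonneg_right (fock n)
  have hfin : ∑' n, ENNReal.ofReal (diag ρ n) ≠ ∞ := by
    have h := hρ.traceClass
    rw [traceNorm, CFC.abs_of_nonneg ρ
      ((ContinuousLinearMap.nonneg_iff_isPositive ρ).2 hρ.isPositive)] at h
    exact h.ne
  have hs : Summable (diag ρ) := by
    have := ENNReal.summable_toReal hfin
    simpa [ENNReal.toReal_ofReal (h0 _)] using this
  have h1 := ofReal_trace ρ hρ.isPositive hfin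
  rw [hρ.trace_eq_one, ← ENNReal.ofReal_tsum_of_nonneg h0 hs, Complex.one_re,
    ENNReal.ofReal_eq_ofReal_iff zero_le_one (tsum_nonneg h0)] at h1
  rw [h1]
  exact hs.hasSum

/-- The Cauchy-Schwarz inequality for the form of a positive operator. -/
theorem norm_inner_sq_le {ρ : Cavity →L[ℂ] Cavity} (hρ : ρ.IsPositive) (φ ψ : Cavity) :
    ‖inner ℂ φ (ρ ψ)‖ ^ 2 ≤ (inner ℂ φ (ρ φ)).re * (inner ℂ ψ (ρ ψ)).re := by
  obtain ⟨S, rfl⟩ := CStarAlgebra.nonneg_iff_eq_star_mul_self.1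
    ((ContinuousLinearMap.nonneg_iff_isPositive ρ).2 hρ)
  have h : ∀ x y, inner ℂ x ((star S * S) y) = inner ℂ (S x) (S y) := fun x y => by
    rw [ContinuousLinearMap.star_eq_adjoint, _root_.mul_apply_eq_comp,
      ContinuousLinearMap.adjoint_inner_right]
  have h2 : ∀ x, (inner ℂ (S x) (S x)).re = ‖S x‖ ^ 2 := fun x =>
    inner_self_eq_norm_sq (𝕜 := ℂ) (S x)
  rw [h, h, h, h2, h2, ← mul_pow]
  exact pow_le_pow_left₀ (norm_nonneg _) (norm_inner_le_norm _ _) 2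

/-- Cauchy-Schwarz for the form of `M`, at the vectors `M ψ` and `ψ`. -/
theorem apply_eq_zero_of_re_inner {M : Cavity →L[ℂ] Cavity} (hM : M.IsPositive) {ψ : Cavity}
    (h : (inner ℂ ψ (M ψ)).re = 0) : M ψ = 0 := by
  have h1 := norm_inner_sq_le hM (M ψ) ψ
  rw [h, mul_zero] at h1
  have h2 : ‖inner ℂ (M ψ) (M ψ)‖ = 0 := by
    nlinarith [norm_nonneg (inner ℂ (M ψ) (M ψ))]
  exact inner_self_eq_zero.1 (norm_eq_zero.1 h2)

/-- This is `ρ² ≤ ρ`: sum `|⟨n, ρ φ⟩|² ≤ ⟨n, ρ n⟩ ⟨φ, ρ φ⟩` over `n` and use that the trace is one.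
-/
theorem IsState.norm_sq_apply_le {ρ : Cavity →L[ℂ] Cavity} (hρ : IsState ρ) (φ : Cavity) :
    ‖ρ φ‖ ^ 2 ≤ (inner ℂ φ (ρ φ)).re := by
  have h1 := hasSum_norm_sq_coord (ρ φ)
  have h2 := hρ.hasSum_diag.mul_right (inner ℂ φ (ρ φ)).re
  rw [one_mul] at h2
  refine hasSum_le (fun n => ?_) h1 h2
  rw [← inner_fock]
  exact norm_inner_sq_le hρ.isPositive _ _

/-- A positive operator whose range meets the orthogonal of `φ` trivially has rank one. -/
theorem apply_eq_of_range_inf_orthogonal {M : Cavity →L[ℂ] Cavity} (hM : M.IsPositive) {φ : Cavity}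
    (h : ∀ χ, inner ℂ φ (M χ) = 0 → M χ = 0) :
    ∃ κ : ℝ, 0 ≤ κ ∧ HasSum (diag M) κ ∧ M (M φ) = (κ : ℂ) • M φ ∧ (M φ = 0 → κ = 0) := by
  have hsym : ∀ χ, inner ℂ φ (M χ) = inner ℂ (M φ) χ := fun χ =>
    (hM.inner_left_eq_inner_right φ χ).symm
  by_cases hw : M φ = 0
  · have h0 : ∀ χ, M χ = 0 := fun χ => h χ (by rw [hsym, hw, inner_zero_left])
    have hd : diag M = fun _ => 0 := by
      ext1 n
      simp [diag, h0]
    exact ⟨0, le_rfl, by rw [hd]; exact hasSum_zero, by simp [h0], fun _ => rfl⟩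
  have hm := Complex.eq_re_of_ofReal_le (hM.inner_nonneg_right φ)
  set r : ℝ := (inner ℂ φ (M φ)).re with hr
  have hr0 : 0 ≤ r := hM.re_inner_nonneg_right φ
  have hrne : r ≠ 0 := fun hz => hw (h φ (by rw [hm, hz]; simp))
  have hrc : (r : ℂ) ≠ 0 := Complex.ofReal_ne_zero.2 hrne
  -- The image of `χ - (⟨M φ, χ⟩ / r) φ` is orthogonal to `φ`, hence zero. So `M = |Mφ⟩⟨Mφ| / r`,
  -- and `‖M φ‖² / r` is both its trace and its eigenvalue.
  have hone : ∀ χ, M χ = (inner ℂ (M φ) χ / r) • M φ := fun χ => by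
    have h1 : M (χ - (inner ℂ (M φ) χ / r) • φ) = 0 := by
      apply h
      rw [map_sub, map_smul, inner_sub_right, inner_smul_right, hsym, hm]
      field_simp
      simp
    rwa [map_sub, map_smul, sub_eq_zero] at h1
  refine ⟨‖M φ‖ ^ 2 / r, by positivity, ?_, ?_, fun h0 => absurd h0 hw⟩
  · have := (hasSum_norm_sq_coord (M φ)).div_const r
    refine (congrArg (HasSum · _) (funext fun n => ?_)).mpr this
    change (inner ℂ (fock n) (M (fock n))).re = _
    rw [hone (fock n), inner_smul_right, ← inner_conj_symm (M φ), inner_fock, div_mul_eq_mul_div,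
      ← Complex.normSq_eq_conj_mul_self, ← Complex.ofReal_div, Complex.ofReal_re,
      Complex.normSq_eq_norm_sq]
  · rw [hone (M φ), inner_self_eq_norm_sq_to_K]
    push_cast
    rfl

/-- The form of a state nearly dominates `|φ⟩⟨φ|` when its mean value at `φ` is near `1`. -/
theorem norm_inner_sq_sub_le {ρ : Cavity →L[ℂ] Cavity} (hρ : IsState ρ) {φ : Cavity}
    (hφ : ‖φ‖ = 1) (w : Cavity) :
    ‖inner ℂ φ w‖ ^ 2 - (inner ℂ w (ρ w)).re
      ≤ 3 * √(1 - (inner ℂ φ (ρ φ)).re) * ‖w‖ ^ 2 := by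
  set F := (inner ℂ φ (ρ φ)).re with hF
  have hFc : inner ℂ φ (ρ φ) = (F : ℂ) :=
    Complex.eq_re_of_ofReal_le (hρ.isPositive.inner_nonneg_right φ)
  have hF0 : 0 ≤ F := hρ.isPositive.re_inner_nonneg_right φ
  have hρφ : ‖ρ φ‖ ^ 2 ≤ F := hρ.norm_sq_apply_le φ
  -- `ρ φ - F φ` is the component of `ρ φ` orthogonal to `φ`; its squared norm is at most `F - F² ≤
  -- 1 - F`, so `φ` is nearly an eigenvector.
  have hr2 : ‖ρ φ - (F : ℂ) • φ‖ ^ 2 = ‖ρ φ‖ ^ 2 - F ^ 2 := by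
    rw [norm_sub_sq (𝕜 := ℂ), inner_smul_right, ← inner_conj_symm, hFc, norm_smul, hφ]
    simp
    ring
  have hF1 : F ≤ 1 := by nlinarith [sq_nonneg ‖ρ φ - (F : ℂ) • φ‖]
  set s := √(1 - F) with hs
  have hs2 : s ^ 2 = 1 - F := Real.sq_sqrt (by linarith)
  have hs0 : 0 ≤ s := Real.sqrt_nonneg _
  have hs1 : s ≤ 1 := by nlinarith
  have hr : ‖ρ φ - (F : ℂ) • φ‖ ≤ s := abs_le_of_sq_le_sq' (by nlinarith) hs0 |>.2
  set a : ℂ := inner ℂ φ w with ha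
  set v := w - a • φ with hv
  have hφφ : inner ℂ φ φ = (1 : ℂ) := by rw [inner_self_eq_norm_sq_to_K, hφ]; simp
  have hvφ : inner ℂ v φ = 0 := by
    rw [← inner_conj_symm, hv, inner_sub_right, inner_smul_right, hφφ, ← ha, mul_one, sub_self,
      map_zero]
  have hwv : w = a • φ + v := by rw [hv]; abel
  have hnorm : ‖w‖ ^ 2 = ‖a‖ ^ 2 + ‖v‖ ^ 2 := by
    rw [hwv, norm_add_sq (𝕜 := ℂ), inner_smul_left, ← inner_conj_symm φ v, hvφ, norm_smul, hφ]
    simp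
  have hcross : ‖inner ℂ v (ρ φ)‖ ≤ ‖v‖ * s := by
    have : inner ℂ v (ρ φ) = inner ℂ v (ρ φ - (F : ℂ) • φ) := by
      rw [inner_sub_right, inner_smul_right, hvφ, mul_zero, sub_zero]
    rw [this]
    exact (norm_inner_le_norm _ _).trans (mul_le_mul_of_nonneg_left hr (norm_nonneg _))
  -- Expansion along `w = a φ + v` with `v ⊥ φ`. The cross term is of order `√(1 - F)`, which is the
  -- source of the square root.
  have hquad : (inner ℂ w (ρ w)).re
      = ‖a‖ ^ 2 * F + 2 * (a * inner ℂ v (ρ φ)).re + (inner ℂ v (ρ v)).re := by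
    have e1 : inner ℂ φ (ρ v) = (starRingEnd ℂ) (inner ℂ v (ρ φ)) := by
      rw [inner_conj_symm, hρ.isPositive.inner_left_eq_inner_right]
    have e2 : (starRingEnd ℂ) a * (a * (F : ℂ)) = ((‖a‖ ^ 2 * F : ℝ) : ℂ) := by
      rw [← mul_assoc, ← Complex.normSq_eq_conj_mul_self, Complex.normSq_eq_norm_sq]
      push_cast; rfl
    rw [hwv, map_add, map_smul, inner_add_left, inner_add_right, inner_add_right,
      inner_smul_left, inner_smul_left, inner_smul_right, inner_smul_right, hFc, e1, e2,
      ← map_mul, Complex.add_re, Complex.add_re, Complex.add_re, Complex.conj_re,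
      Complex.ofReal_re]
    ring
  have hcr : -(‖a‖ * (‖v‖ * s)) ≤ (a * inner ℂ v (ρ φ)).re := by
    have h1 := Complex.abs_re_le_norm (a * inner ℂ v (ρ φ))
    rw [norm_mul] at h1
    have h2 := mul_le_mul_of_nonneg_left hcross (norm_nonneg a)
    have h3 := neg_abs_le (a * inner ℂ v (ρ φ)).re
    linarith
  have hv0 : 0 ≤ (inner ℂ v (ρ v)).re := hρ.isPositive.re_inner_nonneg_right v
  have h1 : ‖a‖ * ‖v‖ * 2 ≤ ‖w‖ ^ 2 := by nlinarith [sq_nonneg (‖a‖ - ‖v‖)]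
  have h2 : ‖a‖ ^ 2 * (1 - F) ≤ s * ‖w‖ ^ 2 := by
    rw [← hs2]
    have h4 : s ^ 2 ≤ s := by nlinarith
    have h5 : ‖a‖ ^ 2 ≤ ‖w‖ ^ 2 := by rw [hnorm]; nlinarith [sq_nonneg ‖v‖]
    rw [mul_comm]
    exact mul_le_mul h4 h5 (sq_nonneg _) hs0
  have h3 : s * (‖a‖ * ‖v‖ * 2) ≤ s * ‖w‖ ^ 2 := mul_le_mul_of_nonneg_left h1 hs0
  rw [hquad]
  -- The estimates give the constant `2`; the stated `3` is not sharp.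
  nlinarith [mul_nonneg hs0 (sq_nonneg ‖w‖)]

/-- The difference `T` is nonnegative on the orthogonal of `φ`, so its negative part `M` has rank at
most one, with trace and eigenvalue `κ`. As `T` has trace zero, its trace norm is `2κ`; testing `T`
on an eigenvector of `M` bounds `κ` by `norm_inner_sq_sub_le`. -/
theorem traceNorm_sub_ketBra_le {ρ : Cavity →L[ℂ] Cavity} (hρ : IsState ρ) {φ : Cavity}
    (hφ : ‖φ‖ = 1) :
    traceNorm (ρ - ketBra φ) ≤ ENNReal.ofReal (6 * √(1 - (inner ℂ φ (ρ φ)).re)) := by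
  set T := ρ - ketBra φ with hT
  have hTs : IsSelfAdjoint T := hρ.isPositive.isSelfAdjoint.sub (isPositive_ketBra φ).isSelfAdjoint
  set M := T⁻ with hM
  have hMpos : M.IsPositive :=
    (ContinuousLinearMap.nonneg_iff_isPositive M).1 (CFC.negPart_nonneg T)
  have habs : CFC.abs T = T + M + M := by
    have := CFC.abs_sub_self T hTs
    rw [sub_eq_iff_eq_add, ← hM, two_smul] at this
    rw [this]; abel
  have hTM : T * M = -(M * M) := by
    have h1 := CFC.posPart_sub_negPart T hTs
    have h2 := CFC.posPart_mul_negPart T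
    calc T * M = (T⁺ - T⁻) * M := by rw [h1]
      _ = -(M * M) := by rw [sub_mul, h2, zero_sub]
  have hTMx : ∀ χ, T (M χ) = -M (M χ) := fun χ => by
    simpa using DFunLike.congr_fun hTM χ
  -- For `ψ` in the range of `M` and orthogonal to `φ`, `⟨ψ, ρ ψ⟩ = ⟨ψ, T ψ⟩ = -⟨ψ, M ψ⟩`. Both
  -- forms are nonnegative, so `M ψ = 0`; a vector of the range that lies in the kernel of a
  -- self-adjoint operator is zero.
  have hr : ∀ χ, inner ℂ φ (M χ) = 0 → M χ = 0 := by
    intro χ hχ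
    set ψ := M χ with hψ
    have h1 : inner ℂ ψ (T ψ) = inner ℂ ψ (ρ ψ) := by
      rw [hT, _root_.sub_apply, ketBra_apply, hχ, zero_smul, sub_zero]
    rw [hTMx, inner_neg_right] at h1
    have h2 := congrArg Complex.re h1
    rw [Complex.neg_re] at h2
    have h3 : 0 ≤ (inner ℂ ψ (ρ ψ)).re := hρ.isPositive.re_inner_nonneg_right ψ
    have h4 : 0 ≤ (inner ℂ ψ (M ψ)).re := hMpos.re_inner_nonneg_right ψ
    have h5 : M ψ = 0 := apply_eq_zero_of_re_inner hMpos (by linarith)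
    have h6 := hMpos.inner_left_eq_inner_right χ ψ
    rw [h5, inner_zero_right] at h6
    exact inner_self_eq_zero.1 h6
  obtain ⟨κ, hκ, hsum, heig, hz⟩ := apply_eq_of_range_inf_orthogonal hMpos hr
  have hdT : HasSum (diag T) 0 := by
    have h1 := hρ.hasSum_diag.sub (hasSum_norm_sq_coord φ)
    rw [hφ, one_pow, sub_self] at h1
    refine (congrArg (HasSum · _) (funext fun n => ?_)).mpr h1
    change (inner ℂ (fock n) (T (fock n))).re = (inner ℂ (fock n) (ρ (fock n))).re - _
    rw [hT, _root_.sub_apply, inner_sub_right, Complex.sub_re,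
      ketBra_apply, inner_smul_right, ← inner_conj_symm φ, ← inner_fock (ψ := φ), ← Complex.normSq_eq_conj_mul_self,
      Complex.ofReal_re, Complex.normSq_eq_norm_sq]
  have htn : traceNorm T = ENNReal.ofReal (2 * κ) := by
    have h1 : HasSum (diag (CFC.abs T)) (2 * κ) := by
      have h2 := (hdT.add hsum).add hsum
      rw [zero_add, ← two_mul] at h2
      convert h2 using 1
      ext1 n
      simp [diag, habs]
    have h0 : ∀ n, 0 ≤ diag (CFC.abs T) n := fun n =>
      ((ContinuousLinearMap.nonneg_iff_isPositive _).1 (CFC.abs_nonneg T)).re_inner_nonneg_right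
        (fock n)
    rw [← h1.tsum_eq, ENNReal.ofReal_tsum_of_nonneg h0 h1.summable]
    rfl
  rw [htn]
  refine ENNReal.ofReal_le_ofReal ?_
  by_cases hw : M φ = 0
  · rw [hz hw, mul_zero]
    positivity
  set w := M φ with hwdef
  have heigw : κ * ‖w‖ ^ 2 = ‖inner ℂ φ w‖ ^ 2 - (inner ℂ w (ρ w)).re := by
    have h1 : T w = -((κ : ℂ) • w) := by rw [hwdef, hTMx, heig]
    rw [hT, _root_.sub_apply, ketBra_apply] at h1
    have h2 := congrArg (fun x => (inner ℂ w x).re) h1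
    simp only [inner_sub_right, inner_neg_right, inner_smul_right, Complex.sub_re,
      Complex.neg_re] at h2
    rw [← inner_conj_symm w φ, Complex.mul_conj, Complex.ofReal_re,
      Complex.normSq_eq_norm_sq, Complex.re_ofReal_mul] at h2
    have h3 : (inner ℂ w w).re = ‖w‖ ^ 2 := inner_self_eq_norm_sq (𝕜 := ℂ) w
    rw [h3] at h2
    linarith
  have hwpos : 0 < ‖w‖ ^ 2 := by positivity
  have hfin := norm_inner_sq_sub_le hρ hφ w
  rw [← heigw] at hfin
  have := le_of_mul_le_mul_right hfin hwpos
  linarith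

/-! ### Evolution of the Fock states -/

theorem inner_fock_fock (k j : ℕ) : inner ℂ (fock k) (fock j) = if k = j then (1 : ℂ) else 0 :=
  orthonormal_iff_ite.1 fockBasis.orthonormal k j

theorem amp_ne_zero {m : Params} {y : Outcome} {n : ℕ} (h : m.amp y n ≠ 0) :
    (n : ℤ) = src y n + δ y := by
  rcases y with ⟨_ | _, _ | _⟩
  · simp [src, δ]
  · simp [src, δ]
  -- Truncated subtraction gives the vacuum itself as source, but the amplitude carries the factor
  -- `√0` there.
  · rcases n with _ | n
    · simp [Params.amp] at h
    · simp [src, δ]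
  · simp [src, δ]

/-- Each coordinate of `V_y ψ` reads a single coordinate of `ψ`, so the adjoint sends Fock vectors
to multiples of Fock vectors. The label `k` carries information only when the coefficient is
nonzero. -/
theorem exists_star_W_fock (m : Params) (t : ℕ) (ω : Ω) (j : ℕ) :
    ∃ (k : ℕ) (a : ℂ), star (m.W ω t) (fock j) = a • fock k ∧
      (a ≠ 0 → (j : ℤ) = k + shift t ω) := by
  induction t generalizing j with
  | zero => exact ⟨j, 1, by simp [Params.W], by simp [shift]⟩
  | succ t ih =>
    obtain ⟨k, a, h1, h2⟩ := ih (src (ω t) j)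
    refine ⟨k, (starRingEnd ℂ) (m.amp (ω t) j) * a, ?_, fun h => ?_⟩
    · rw [Params.W, star_mul, _root_.mul_apply_eq_comp, star_V_fock, map_smul, h1, smul_smul]
    · have h3 := amp_ne_zero (m := m) (y := ω t) (n := j) fun h0 => h (by simp [h0])
      have h4 := h2 (right_ne_zero_of_mul h)
      rw [h3, h4, shift, shift, Finset.sum_range_succ]
      ring

theorem inner_W (m : Params) (t : ℕ) (ω : Ω) (φ ψ : Cavity) :
    inner ℂ φ (m.W ω t ψ) = inner ℂ (star (m.W ω t) φ) ψ := by
  rw [ContinuousLinearMap.star_eq_adjoint, ContinuousLinearMap.adjoint_inner_left]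

theorem repr_W_fock_ne_zero {m : Params} {t : ℕ} {ω : Ω} {k j : ℕ}
    (h : fockBasis.repr (m.W ω t (fock k)) j ≠ 0) : (j : ℤ) = k + shift t ω := by
  obtain ⟨k', a, h1, h2⟩ := exists_star_W_fock m t ω j
  rw [← inner_fock, inner_W, h1, inner_smul_left, inner_fock_fock] at h
  have hk : k' = k := by
    by_contra hne
    simp [hne] at h
  subst hk
  exact h2 fun h0 => h (by simp [h0])

/-- Only the coordinate `k + s_t` can be nonzero. If this integer is negative, all coordinates
vanish and `toNat` does no harm. -/
theorem norm_sq_W_fock (m : Params) (t : ℕ) (ω : Ω) (k : ℕ) :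
    ‖m.W ω t (fock k)‖ ^ 2
      = ‖fockBasis.repr (m.W ω t (fock k)) (k + shift t ω).toNat‖ ^ 2 := by
  refine (hasSum_norm_sq_coord _).unique (hasSum_single _ fun j hj => ?_)
  have : fockBasis.repr (m.W ω t (fock k)) j = 0 := by
    by_contra h
    have := repr_W_fock_ne_zero h
    omega
  simp [this]

theorem shift_nonneg_of_W_fock_ne_zero {m : Params} {t : ℕ} {ω : Ω} {k : ℕ}
    (h : m.W ω t (fock k) ≠ 0) : 0 ≤ k + shift t ω := by
  have h1 : fockBasis.repr (m.W ω t (fock k)) (k + shift t ω).toNat ≠ 0 := fun h0 => by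
    have h2 := norm_sq_W_fock m t ω k
    rw [h0] at h2
    simp [h] at h2
  have := repr_W_fock_ne_zero h1
  omega

theorem W_fock_eq (m : Params) (t : ℕ) (ω : Ω) (k : ℕ) :
    m.W ω t (fock k) = fockBasis.repr (m.W ω t (fock k)) (k + shift t ω).toNat •
      fock (k + shift t ω).toNat := by
  apply fockBasis.repr.injective
  ext j
  rw [map_smul, lp.coeFn_smul, Pi.smul_apply, ← inner_fock (ψ := fock _), inner_fock_fock]
  by_cases hj : j = (k + shift t ω).toNat
  · simp [← hj]
  · have : fockBasis.repr (m.W ω t (fock k)) j = 0 := by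
      by_contra h
      have := repr_W_fock_ne_zero h
      omega
    simp [this, hj]

/-- The coherences of `ρ` never enter the diagonal of the evolved operator; the law of the outcomes
thus sees only the diagonal of `ρ`. -/
theorem diag_unnormalized (m : Params) (ρ : Cavity →L[ℂ] Cavity) {t : ℕ} {ω : Ω} {j k : ℕ} {a : ℂ}
    (h : star (m.W ω t) (fock j) = a • fock k) :
    diag (m.unnormalized ρ t ω) j = ‖a‖ ^ 2 * diag ρ k := by
  have h1 : inner ℂ (fock j) (m.unnormalized ρ t ω (fock j))
      = ((‖a‖ ^ 2 : ℝ) : ℂ) * inner ℂ (fock k) (ρ (fock k)) := by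
    rw [Params.unnormalized, _root_.mul_apply_eq_comp, _root_.mul_apply_eq_comp, inner_W, h,
      map_smul, inner_smul_left, inner_smul_right, ← mul_assoc, ← Complex.normSq_eq_conj_mul_self,
      Complex.normSq_eq_norm_sq]
  rw [diag, h1, Complex.re_ofReal_mul, diag]

theorem norm_repr_W_fock (m : Params) {t : ℕ} {ω : Ω} {j k : ℕ} {a : ℂ}
    (h : star (m.W ω t) (fock j) = a • fock k) (k' : ℕ) :
    ‖fockBasis.repr (m.W ω t (fock k')) j‖ ^ 2 = if k = k' then ‖a‖ ^ 2 else 0 := by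
  rw [← inner_fock, inner_W, h, inner_smul_left, inner_fock_fock]
  split_ifs <;> simp

theorem ofReal_diag_unnormalized (m : Params) (ρ : Cavity →L[ℂ] Cavity) (t : ℕ) (ω : Ω) (j : ℕ) :
    ENNReal.ofReal (diag (m.unnormalized ρ t ω) j) = ∑' k, ENNReal.ofReal (diag ρ k) *
      ENNReal.ofReal (‖fockBasis.repr (m.W ω t (fock k)) j‖ ^ 2) := by
  obtain ⟨k, a, h, -⟩ := exists_star_W_fock m t ω j
  simp only [norm_repr_W_fock m h]
  rw [diag_unnormalized m ρ h, tsum_eq_single k fun k' hk' => by simp [hk'.symm], if_pos rfl,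
    mul_comm, ENNReal.ofReal_mul' (sq_nonneg _)]

theorem diag_unnormalized_of_W_fock_ne_zero (m : Params) (ρ : Cavity →L[ℂ] Cavity) {t : ℕ} {ω : Ω}
    {k : ℕ} (h : m.W ω t (fock k) ≠ 0) :
    diag (m.unnormalized ρ t ω) (k + shift t ω).toNat
      = diag ρ k * ‖m.W ω t (fock k)‖ ^ 2 := by
  obtain ⟨k', a, h1, -⟩ := exists_star_W_fock m t ω (k + shift t ω).toNat
  have h2 := norm_sq_W_fock m t ω k
  rw [norm_repr_W_fock m h1] at h2
  have hk : k' = k := by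
    by_contra hne
    rw [if_neg hne] at h2
    simp [h] at h2
  subst hk
  rw [if_pos rfl] at h2
  rw [diag_unnormalized m ρ h1, h2, mul_comm]

/-- Tonelli turns the diagonal coefficients into the weight of a word, as a mixture of its weights
for the Fock states. -/
theorem tsum_diag_unnormalized (m : Params) (ρ : Cavity →L[ℂ] Cavity) (t : ℕ) (ω : Ω) :
    ∑' j, ENNReal.ofReal (diag (m.unnormalized ρ t ω) j) = ∑' k, ENNReal.ofReal (diag ρ k) *
      ENNReal.ofReal (‖m.W ω t (fock k)‖ ^ 2) := by
  simp only [ofReal_diag_unnormalized]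
  rw [ENNReal.tsum_comm]
  refine tsum_congr fun k => ?_
  have h := hasSum_norm_sq_coord (m.W ω t (fock k))
  rw [ENNReal.tsum_mul_left, ← h.tsum_eq,
    ENNReal.ofReal_tsum_of_nonneg (fun _ => sq_nonneg _) h.summable]

/-! ### The law of the outcomes as a mixture of Fock laws -/

theorem IsState.diag_nonneg {ρ : Cavity →L[ℂ] Cavity} (hρ : IsState ρ) (n : ℕ) : 0 ≤ diag ρ n :=
  hρ.isPositive.re_inner_nonneg_right (fock n)

theorem IsState.tsum_ofReal_diag {ρ : Cavity →L[ℂ] Cavity} (hρ : IsState ρ) :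
    ∑' n, ENNReal.ofReal (diag ρ n) = 1 := by
  rw [← ENNReal.ofReal_tsum_of_nonneg hρ.diag_nonneg hρ.hasSum_diag.summable,
    hρ.hasSum_diag.tsum_eq, ENNReal.ofReal_one]

theorem isPositive_unnormalized (m : Params) {ρ : Cavity →L[ℂ] Cavity} (hρ : IsState ρ) (t : ℕ)
    (ω : Ω) : (m.unnormalized ρ t ω).IsPositive :=
  hρ.isPositive.conj_adjoint (m.W ω t)

theorem tsum_diag_unnormalized_ne_top (m : Params) {ρ : Cavity →L[ℂ] Cavity} (hρ : IsState ρ)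
    (t : ℕ) (ω : Ω) : ∑' j, ENNReal.ofReal (diag (m.unnormalized ρ t ω) j) ≠ ∞ := by
  rw [tsum_diag_unnormalized]
  refine ne_top_of_le_ne_top (b := 1 * ENNReal.ofReal (‖m.W ω t‖ ^ 2)) (by simp) ?_
  rw [← hρ.tsum_ofReal_diag, ← ENNReal.tsum_mul_right]
  refine ENNReal.tsum_le_tsum fun k => ?_
  gcongr
  simpa [norm_fock] using (m.W ω t).le_opNorm (fock k)

theorem law_cyl (m : Params) {ρ : Cavity →L[ℂ] Cavity} (hρ : IsState ρ) (t : ℕ) (ω : Ω) :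
    m.law ρ (cyl t ω) = ∑' k, ENNReal.ofReal (diag ρ k) *
      ENNReal.ofReal (‖m.W ω t (fock k)‖ ^ 2) := by
  rw [← tsum_diag_unnormalized, ← ofReal_trace _ (isPositive_unnormalized m hρ t ω)
    (tsum_diag_unnormalized_ne_top m hρ t ω)]
  exact (isOutcomeLaw_law m hρ).cylinder t ω

theorem isProbabilityMeasure_law (m : Params) {ρ : Cavity →L[ℂ] Cavity} (hρ : IsState ρ) :
    IsProbabilityMeasure (m.law ρ) :=
  (isOutcomeLaw_law m hρ).isProbabilityMeasure

theorem diag_ketBra_fock (k n : ℕ) : diag (ketBra (fock k)) n = if n = k then 1 else 0 := by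
  rw [diag, ketBra_apply, inner_smul_right, inner_fock_fock, inner_fock_fock]
  by_cases h : n = k
  · simp [h]
  · simp [h]

theorem isState_ketBra_fock (k : ℕ) : IsState (ketBra (fock k)) := by
  have hfin : ∑' n, ENNReal.ofReal (diag (ketBra (fock k)) n) = 1 := by
    simp only [diag_ketBra_fock]
    rw [tsum_eq_single k fun n hn => by simp [hn]]
    simp
  refine ⟨isPositive_ketBra _, ?_, ?_⟩
  · rw [traceNorm, CFC.abs_of_nonneg _
      ((ContinuousLinearMap.nonneg_iff_isPositive _).2 (isPositive_ketBra _))]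
    change ∑' n, ENNReal.ofReal (diag (ketBra (fock k)) n) < ∞
    rw [hfin]
    exact ENNReal.one_lt_top
  · rw [trace, tsum_eq_single k fun n hn => ?_]
    · simp [ketBra_apply, norm_fock]
    · rw [ketBra_apply, inner_smul_right, inner_fock_fock, if_neg hn.symm, zero_mul]

/-- The law of the outcomes when the initial state is `|k⟩⟨k|`. -/
def Params.fockLaw (m : Params) (k : ℕ) : Measure Ω := m.law (ketBra (fock k))

instance (m : Params) (k : ℕ) : IsProbabilityMeasure (m.fockLaw k) :=
  isProbabilityMeasure_law m (isState_ketBra_fock k)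

theorem fockLaw_cyl (m : Params) (k t : ℕ) (ω : Ω) :
    m.fockLaw k (cyl t ω) = ENNReal.ofReal (‖m.W ω t (fock k)‖ ^ 2) := by
  rw [Params.fockLaw, law_cyl m (isState_ketBra_fock k),
    tsum_eq_single k fun n hn => by simp [diag_ketBra_fock, hn]]
  simp [diag_ketBra_fock]

/-- Both sides agree on cylinders. Almost sure statements thereby reduce to Fock initial states. -/
theorem law_eq_sum (m : Params) {ρ : Cavity →L[ℂ] Cavity} (hρ : IsState ρ) :
    m.law ρ = Measure.sum fun k => ENNReal.ofReal (diag ρ k) • m.fockLaw k := by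
  have := isProbabilityMeasure_law m hρ
  refine ext_of_cyl fun t ω => ?_
  rw [law_cyl m hρ, Measure.sum_apply _ (measurableSet_cyl t ω)]
  exact tsum_congr fun k => by rw [Measure.smul_apply, fockLaw_cyl, smul_eq_mul]

theorem ae_law (m : Params) {ρ : Cavity →L[ℂ] Cavity} (hρ : IsState ρ) {p : Ω → Prop}
    (h : ∀ k, ∀ᵐ ω ∂(m.fockLaw k), p ω) : ∀ᵐ ω ∂(m.law ρ), p ω := by
  rw [law_eq_sum m hρ, Measure.ae_sum_iff]
  exact fun k => Measure.ae_smul_measure (h k) _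

/-- A word that annihilates `|k⟩` has weight `‖W_t|k⟩‖² = 0`. -/
theorem ae_fockLaw_W_ne_zero (m : Params) (k : ℕ) :
    ∀ᵐ ω ∂(m.fockLaw k), ∀ t, m.W ω t (fock k) ≠ 0 := by
  refine ae_all_iff.2 fun t => ?_
  have := measure_setOf_eq_zero (μ := m.fockLaw k) (t := t)
    (p := fun ω => m.W ω t (fock k) = 0) fun ω h => by simp [fockLaw_cyl, h]
  rw [ae_iff]
  simpa using this

theorem measurableSet_W_fock (m : Params) (t k : ℕ) :
    MeasurableSet {ω | m.W ω t (fock k) ≠ 0} :=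
  measurableSet_setOfPred.2 <| measurable_of_dependsOn (t := t) fun ω ω' h => by
    rw [W_congr m t ω ω' h]

/-! ### The Markov property and recurrence -/

/-- The sequence of outcomes with first outcome `y`, continued by `ω`. -/
def consOutcome (y : Outcome) (ω : Ω) : Ω
  | 0 => y
  | n + 1 => ω n

theorem measurable_consOutcome (y : Outcome) : Measurable (consOutcome y) := by
  refine measurable_pi_iff.2 fun n => ?_
  cases n with
  | zero => exact measurable_const
  | succ n => exact measurable_pi_apply n

theorem consOutcome_head_tail (ω : Ω) : consOutcome (ω 0) (fun i => ω (i + 1)) = ω := by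
  ext1 n
  cases n <;> rfl

theorem shift_consOutcome (y : Outcome) (t : ℕ) (ω : Ω) :
    shift (t + 1) (consOutcome y ω) = δ y + shift t ω := by
  rw [shift, Finset.sum_range_succ', add_comm]
  rfl

theorem W_consOutcome (m : Params) (y : Outcome) (t : ℕ) (ω : Ω) :
    m.W (consOutcome y ω) (t + 1) = m.W ω t * m.V y := by
  induction t with
  | zero => simp [Params.W, consOutcome]
  | succ t ih =>
    rw [Params.W, ih, Params.W, mul_assoc]
    rfl

theorem exists_V_fock (m : Params) (y : Outcome) (x : ℕ) :
    ∃ c : ℂ, m.V y (fock x) = c • fock (x + δ y).toNat := by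
  have h := W_fock_eq m 1 (fun _ => y) x
  simp only [Params.W, mul_one, shift, Finset.sum_range_one] at h
  exact ⟨_, h⟩

theorem norm_sq_W_consOutcome_fock (m : Params) (y : Outcome) (t : ℕ) (ω : Ω) (x : ℕ) :
    ‖m.W (consOutcome y ω) (t + 1) (fock x)‖ ^ 2
      = ‖m.V y (fock x)‖ ^ 2 * ‖m.W ω t (fock (x + δ y).toNat)‖ ^ 2 := by
  obtain ⟨c, hc⟩ := exists_V_fock m y x
  rw [W_consOutcome, _root_.mul_apply_eq_comp, hc, map_smul, norm_smul, norm_smul, norm_fock]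
  ring

theorem norm_sq_V_fock (m : Params) (y : Outcome) (x : ℕ) :
    ‖m.V y (fock x)‖ ^ 2 = if src y (x + δ y).toNat = x then
      ‖m.amp y (x + δ y).toNat‖ ^ 2 else 0 := by
  have h := norm_sq_W_fock m 1 (fun _ => y) x
  simp only [Params.W, mul_one, shift, Finset.sum_range_one] at h
  rw [h, repr_V, ← inner_fock, inner_fock_fock]
  split_ifs <;> simp

theorem sum_norm_sq_V_fock (m : Params) (x : ℕ) :
    ∑ y, ENNReal.ofReal (‖m.V y (fock x)‖ ^ 2) = 1 := by
  rw [← (isState_ketBra_fock x).tsum_ofReal_diag, ← tsum_diag_conj m]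
  refine Finset.sum_congr rfl fun y _ => ?_
  have h := tsum_diag_unnormalized m (ketBra (fock x)) 1 (fun _ => y)
  simp only [Params.unnormalized, Params.W, mul_one] at h
  rw [h, tsum_eq_single x fun n hn => by simp [diag_ketBra_fock, hn]]
  simp [diag_ketBra_fock]

theorem preimage_consOutcome_cyl (y : Outcome) (t : ℕ) (ω : Ω) :
    consOutcome y ⁻¹' cyl (t + 1) ω = {ω' | y = ω 0 ∧ ω' ∈ cyl t fun i => ω (i + 1)} := by
  ext ω'
  simp only [cyl, Set.mem_preimage, Set.mem_ofPred_eq]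
  constructor
  · exact fun h => ⟨h 0 (by omega), fun i hi => h (i + 1) (by omega)⟩
  · rintro ⟨h1, h2⟩ (_ | i) hi
    · exact h1
    · exact h2 i (by omega)

/-- The Markov property at the first step. -/
theorem fockLaw_eq_sum (m : Params) (x : ℕ) :
    m.fockLaw x = Measure.sum fun y => ENNReal.ofReal (‖m.V y (fock x)‖ ^ 2) •
      (m.fockLaw (x + δ y).toNat).map (consOutcome y) := by
  refine ext_of_cyl fun t ω => ?_
  rw [Measure.sum_apply _ (measurableSet_cyl t ω), tsum_fintype]
  simp only [Measure.smul_apply, smul_eq_mul,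
    Measure.map_apply (measurable_consOutcome _) (measurableSet_cyl t ω)]
  cases t with
  | zero => simp only [cyl_zero, Set.preimage_univ, measure_univ, mul_one, sum_norm_sq_V_fock]
  | succ t =>
    rw [Finset.sum_eq_single (ω 0)]
    · rw [fockLaw_cyl, preimage_consOutcome_cyl]
      simp only [true_and, Set.ofPred_mem_eq]
      rw [fockLaw_cyl, ← ENNReal.ofReal_mul (sq_nonneg _), ← norm_sq_W_consOutcome_fock,
        consOutcome_head_tail]
    · intro y _ hy
      rw [preimage_consOutcome_cyl]
      simp [hy]
    · simp

/-- The event that the number of photons, started from `x`, never vanishes. -/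
def neverEmpty (x : ℕ) : Set Ω := {ω | ∀ t, 1 ≤ x + shift t ω}

theorem measurableSet_neverEmpty (x : ℕ) : MeasurableSet (neverEmpty x) := by
  have : neverEmpty x = ⋂ t, {ω | 1 ≤ x + shift t ω} := by
    ext
    simp [neverEmpty]
  rw [this]
  refine MeasurableSet.iInter fun t => measurableSet_setOfPred.2 <|
    measurable_of_dependsOn (t := t) fun ω ω' h => ?_
  rw [shift, shift, Finset.sum_congr rfl fun i hi => by rw [h i (Finset.mem_range.1 hi)]]

theorem preimage_consOutcome_neverEmpty (y : Outcome) (x : ℕ) :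
    consOutcome y ⁻¹' neverEmpty (x + 1) = neverEmpty ((x + 1 : ℕ) + δ y).toNat := by
  -- One step from a positive number of photons leads to a nonnegative one, so `toNat` loses
  -- nothing.
  have hδ : 0 ≤ ((x + 1 : ℕ) : ℤ) + δ y := by
    rcases y with ⟨_ | _, _ | _⟩ <;> simp [δ] <;> omega
  ext ω
  simp only [neverEmpty, Set.mem_preimage, Set.mem_ofPred_eq, Int.toNat_of_nonneg hδ]
  constructor
  · intro h t
    have := h (t + 1)
    rw [shift_consOutcome] at this
    omega
  · rintro h (_ | t)
    · simp [shift]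
    · have := h t
      rw [shift_consOutcome]
      omega

/-- The probability of never reaching the vacuum. -/
def Params.neverEmptyProb (m : Params) (x : ℕ) : ℝ := (m.fockLaw x).real (neverEmpty x)

theorem neverEmptyProb_zero (m : Params) : m.neverEmptyProb 0 = 0 := by
  have : neverEmpty 0 = ∅ := by
    ext ω
    simp only [neverEmpty, Set.mem_ofPred_eq, Set.mem_empty_iff_false, iff_false]
    intro h
    simpa [shift] using h 0
  simp [Params.neverEmptyProb, this]

/-- First-step analysis: the function is harmonic for the birth-death chain away from the vacuum. -/
theorem neverEmptyProb_succ (m : Params) (x : ℕ) :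
    m.neverEmptyProb (x + 1) = ∑ y, ‖m.V y (fock (x + 1))‖ ^ 2 *
      m.neverEmptyProb ((x + 1 : ℕ) + δ y).toNat := by
  have hm := measurableSet_neverEmpty (x + 1)
  rw [Params.neverEmptyProb, measureReal_def, fockLaw_eq_sum, Measure.sum_apply _ hm, tsum_fintype,
    ENNReal.toReal_sum fun y _ => by
      rw [Measure.smul_apply, smul_eq_mul, Measure.map_apply (measurable_consOutcome _) hm]
      finiteness]
  refine Finset.sum_congr rfl fun y _ => ?_
  rw [Measure.smul_apply, smul_eq_mul, Measure.map_apply (measurable_consOutcome _) hm,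
    preimage_consOutcome_neverEmpty, ENNReal.toReal_mul, ENNReal.toReal_ofReal (sq_nonneg _)]
  rfl

/-- The squared transition amplitude `S(n)² n` of the Rabi oscillation. -/
def Params.rabi (m : Params) (n : ℕ) : ℝ := m.S n ^ 2 * n

theorem rabi_le_one (m : Params) (n : ℕ) : m.rabi n ≤ 1 := by
  have := m.C_S n
  have h2 := sq_nonneg ‖m.C n‖
  unfold Params.rabi
  linarith

/-- A zero would force `sin (π √(ξ n + η)) = 0`, making `ξ n + η` the square of a positive integer.
Absence of resonance thus keeps every link of the chain open. -/
theorem rabi_pos {m : Params} (hlam : m.lam ≠ 0) (hτ : 0 < m.τ) (hres : m.NonResonant) {n : ℕ}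
    (hn : 0 < n) : 0 < m.rabi n := by
  have hξ : 0 < m.ξ := by
    unfold Params.ξ
    have : m.lam * m.τ / Real.pi ≠ 0 :=
      div_ne_zero (mul_ne_zero hlam hτ.ne') Real.pi_ne_zero
    positivity
  have hn' : (0 : ℝ) < n := Nat.cast_pos.2 hn
  set z := m.ξ * n + m.η with hz
  have hz0 : 0 < z := add_pos_of_pos_of_nonneg (mul_pos hξ hn') m.η_nonneg
  have hsin : Real.sin (Real.pi * √z) ≠ 0 := by
    intro h0
    obtain ⟨k, hk⟩ := Real.sin_eq_zero_iff.1 h0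
    have hk' : (k : ℝ) = √z := by
      rw [mul_comm] at hk
      exact mul_left_cancel₀ Real.pi_ne_zero hk
    have hkpos : 0 < k := by
      have : (0 : ℝ) < k := hk' ▸ Real.sqrt_pos.2 hz0
      exact_mod_cast this
    lift k to ℕ using hkpos.le
    refine hres n k hn (by exact_mod_cast hkpos) ?_
    rw [← hz, ← Real.sq_sqrt hz0.le, ← hk']
    simp
  have hS : m.S n ≠ 0 := by
    have h1 := sin_sq_eq z hz0.le
    have h2 : m.sinQuot n ≠ 0 := by
      intro h3
      rw [Params.sinQuot, ← hz] at h3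
      rw [h3] at h1
      have : Real.sin (Real.pi * √z) ^ 2 = 0 := by rw [← h1]; ring
      exact hsin (pow_eq_zero_iff two_ne_zero |>.1 this)
    exact mul_ne_zero (Real.sqrt_pos.2 hξ).ne' h2
  unfold Params.rabi
  positivity

/-- Harmonicity in flux form: `‖C(n)‖² = 1 - r(n)` eliminates the probabilities of staying put,
which leaves a balance between the upward and downward increments. -/
theorem neverEmptyProb_increment (m : Params) (x : ℕ) :
    m.pAt true * (m.rabi (x + 2) * (m.neverEmptyProb (x + 2) - m.neverEmptyProb (x + 1)))
      = m.pAt false * (m.rabi (x + 1) * (m.neverEmptyProb (x + 1) - m.neverEmptyProb x)) := by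
  have h := neverEmptyProb_succ m x
  rw [Fintype.sum_prod_type, Fintype.sum_bool, Fintype.sum_bool, Fintype.sum_bool] at h
  have e1 : (((x + 1 : ℕ) : ℤ) + δ (true, true)).toNat = x + 1 := by simp [δ]
  have e2 : (((x + 1 : ℕ) : ℤ) + δ (true, false)).toNat = x + 2 := by simp [δ]; omega
  have e3 : (((x + 1 : ℕ) : ℤ) + δ (false, true)).toNat = x := by simp [δ]
  have e4 : (((x + 1 : ℕ) : ℤ) + δ (false, false)).toNat = x + 1 := by simp [δ]
  simp only [norm_sq_V_fock, e1, e2, e3, e4, src, if_true,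
    Params.norm_amp_sq, show x + 2 - 1 = x + 1 from rfl] at h
  have h1 := m.C_S (x + 1)
  have h2 := m.C_S (x + 2)
  have h3 := m.pAt_add
  simp only [Params.rabi]
  have c1 : ‖m.C (x + 1)‖ ^ 2 = 1 - m.S (x + 1) ^ 2 * ((x + 1 : ℕ) : ℝ) := by linarith
  have c2 : ‖m.C (x + 1 + 1)‖ ^ 2 = 1 - m.S (x + 2) ^ 2 * ((x + 2 : ℕ) : ℝ) := by linarith
  rw [c1, c2] at h
  linear_combination (-1) * h - m.neverEmptyProb (x + 1) * h3

/-- A bounded function that vanishes at `0` and whose weighted increments grow geometrically is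
zero. -/
theorem eq_zero_of_increment {h g : ℕ → ℝ} {p q : ℝ} (hp : 0 < p) (hpq : p < q) (h0 : h 0 = 0)
    (hn : ∀ x, 0 ≤ h x) (h1 : ∀ x, h x ≤ 1) (hg : ∀ x, 0 < g (x + 1)) (hg1 : ∀ x, g (x + 1) ≤ 1)
    (hinc : ∀ x, p * (g (x + 2) * (h (x + 2) - h (x + 1)))
      = q * (g (x + 1) * (h (x + 1) - h x))) (x : ℕ) : h x = 0 := by
  set E : ℕ → ℝ := fun x => g (x + 1) * (h (x + 1) - h x) with hE
  have hEpow : ∀ x, E x = (q / p) ^ x * E 0 := by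
    intro x
    induction x with
    | zero => simp
    | succ x ih =>
      have : E (x + 1) = q / p * E x := by
        rw [div_mul_eq_mul_div, eq_div_iff hp.ne', mul_comm]
        exact hinc x
      rw [this, ih, pow_succ]
      ring
  have hE0 : 0 ≤ E 0 := by
    simp only [hE, h0, sub_zero]
    exact mul_nonneg (hg 0).le (hn _)
  have hEnn : ∀ x, 0 ≤ E x := fun x => by
    rw [hEpow]
    have : 0 < q := hp.trans hpq
    positivity
  -- The weights are at most `1` and `h` takes values in `[0, 1]`, so the geometric growth of ratio
  -- `q / p > 1` has no room unless `E 0 = 0`.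
  have hEle : ∀ x, E x ≤ 1 := fun x => by
    have hd : 0 ≤ h (x + 1) - h x := by
      by_contra hneg
      have := mul_neg_of_pos_of_neg (hg x) (not_le.1 hneg)
      exact absurd (hEnn x) (not_le.2 this)
    have : E x ≤ 1 * (h (x + 1) - h x) := mul_le_mul_of_nonneg_right (hg1 x) hd
    linarith [hn x, h1 (x + 1)]
  have hEz : E 0 = 0 := by
    by_contra hne
    have hpos : 0 < E 0 := lt_of_le_of_ne hE0 (Ne.symm hne)
    obtain ⟨N, hN⟩ := pow_unbounded_of_one_lt (1 / E 0) ((one_lt_div hp).2 hpq)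
    have := hEle N
    rw [hEpow] at this
    rw [div_lt_iff₀ hpos] at hN
    linarith
  have hstep : ∀ x, h (x + 1) = h x := fun x => by
    have : E x = 0 := by rw [hEpow, hEz, mul_zero]
    have := (mul_eq_zero.1 this).resolve_left (hg x).ne'
    linarith
  induction x with
  | zero => exact h0
  | succ x ih => rw [hstep, ih]

theorem pAt_true_lt {m : Params} (h : 0 < m.β * m.ε) : m.pAt true < m.pAt false := by
  simp only [Params.pAt]
  refine div_lt_div_of_pos_right ?_ (by positivity)
  rw [Real.exp_lt_one_iff]
  linarith

/-- Recurrence: the bounded harmonic function vanishing at `0` is zero, because atoms enter more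
often in the ground state than in the excited one. -/
theorem fockLaw_neverEmpty {m : Params} (hβε : 0 < m.β * m.ε) (hlam : m.lam ≠ 0) (hτ : 0 < m.τ)
    (hres : m.NonResonant) (x : ℕ) : m.fockLaw x (neverEmpty x) = 0 := by
  have hp : 0 < m.pAt true := by
    simp only [Params.pAt]
    positivity
  have := eq_zero_of_increment (h := m.neverEmptyProb) (g := m.rabi) hp (pAt_true_lt hβε)
    (neverEmptyProb_zero m) (fun _ => measureReal_nonneg) (fun _ => measureReal_le_one)
    (fun x => rabi_pos hlam hτ hres x.succ_pos) (fun _ => rabi_le_one m _)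
    (neverEmptyProb_increment m) x
  exact (measureReal_eq_zero_iff).1 this

/-! ### The label of the initial Fock state -/

theorem lt_extinctionTime_iff (m : Params) (k t : ℕ) (ω : Ω) :
    (t : ℕ∞) < m.extinctionTime k ω ↔ ∀ s, 1 ≤ s → s ≤ t → m.W ω s (fock k) ≠ 0 := by
  constructor
  · intro h s hs hst h0
    have h1 : m.extinctionTime k ω ≤ s := iInf₂_le s ⟨hs, h0⟩
    exact absurd (h.trans_le h1) (not_lt.2 (by exact_mod_cast hst))
  · intro h
    -- A strict bound on each candidate time does not pass to an infimum by itself; the bound `t + 1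
    -- ≤ s` does.
    rw [← ENat.add_one_le_iff (ENat.natCast_ne_top t)]
    refine le_iInf₂ fun s hs => ?_
    have : t < s := by
      by_contra hlt
      exact h s hs.1 (not_lt.1 hlt) hs.2
    exact_mod_cast this

theorem evolved_congr (m : Params) (t k : ℕ) {ω ω' : Ω} (h : ∀ i < t, ω i = ω' i) :
    m.evolved t k ω = m.evolved t k ω' := by
  have h1 : (t : ℕ∞) < m.extinctionTime k ω ↔ (t : ℕ∞) < m.extinctionTime k ω' := by
    rw [lt_extinctionTime_iff, lt_extinctionTime_iff]
    refine forall_congr' fun s => forall_congr' fun _ => forall_congr' fun hs => ?_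
    rw [W_congr m s ω ω' fun i hi => h i (hi.trans_le hs)]
  have h2 : shift t ω = shift t ω' :=
    Finset.sum_congr rfl fun i hi => by rw [h i (Finset.mem_range.1 hi)]
  simp only [Params.evolved, h1, h2]

/-- The event that the Fock state `|k⟩` never goes extinct. -/
def Params.survives (m : Params) (k : ℕ) : Set Ω := {ω | ∀ t, m.W ω t (fock k) ≠ 0}

theorem measurableSet_survives (m : Params) (k : ℕ) : MeasurableSet (m.survives k) := by
  have : m.survives k = ⋂ t, {ω | m.W ω t (fock k) ≠ 0} := by
    ext
    simp [Params.survives]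
  rw [this]
  exact MeasurableSet.iInter fun t => measurableSet_W_fock m t k

theorem extinctionTime_eq_top {m : Params} {k : ℕ} {ω : Ω} (h : ω ∈ m.survives k) :
    m.extinctionTime k ω = ⊤ :=
  iInf₂_eq_top.2 fun t ht => absurd ht.2 (h t)

theorem evolved_of_survives {m : Params} {k : ℕ} {ω : Ω} (h : ω ∈ m.survives k) (t : ℕ) :
    m.evolved t k ω = k + shift t ω := by
  rw [Params.evolved, extinctionTime_eq_top h, if_pos (ENat.natCast_lt_top t)]

/-- The second alternative makes the search for a least label total: when nothing survives, `0`
already qualifies. -/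
theorem exists_survives_or (m : Params) (ω : Ω) :
    ∃ k, ω ∈ m.survives k ∨ ∀ l, ω ∉ m.survives l := by
  by_cases h : ∃ k, ω ∈ m.survives k
  · exact h.imp fun k hk => Or.inl hk
  · exact ⟨0, Or.inr (not_exists.1 h)⟩

open Classical in
/-- The least label of a Fock state that never goes extinct (`0` if there is none). -/
def Params.initialLabel (m : Params) (ω : Ω) : ℕ := Nat.find (exists_survives_or m ω)

theorem measurable_initialLabel (m : Params) : Measurable m.initialLabel := by
  classical
  refine measurable_find (exists_survives_or m) fun k => ?_
  have : {ω | ω ∈ m.survives k ∨ ∀ l, ω ∉ m.survives l}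
      = m.survives k ∪ ⋂ l, (m.survives l)ᶜ := by
    ext
    simp
  rw [this]
  exact (measurableSet_survives m k).union
    (MeasurableSet.iInter fun l => (measurableSet_survives m l).compl)

theorem initialLabel_eq {m : Params} {k : ℕ} {ω : Ω} (hk : ω ∈ m.survives k)
    (h : ∀ l < k, ω ∉ m.survives l) : m.initialLabel ω = k := by
  classical
  refine (Nat.find_eq_iff _).2 ⟨Or.inl hk, fun l hl => ?_⟩
  rintro (h1 | h1)
  · exact h l hl h1
  · exact h1 k hk

/-- Survival of `l` forces `l + s_t ≥ 0` at all times, and `k` is larger by at least one. -/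
theorem survives_subset_neverEmpty (m : Params) {l k : ℕ} (h : l < k) :
    m.survives l ⊆ neverEmpty k := fun ω hω t => by
  have := shift_nonneg_of_W_fock_ne_zero (hω t)
  omega

variable {m : Params}

/-- Recurrence excludes the survival of every smaller label. Larger labels may survive as well,
which is why the least one is taken. -/
theorem ae_fockLaw_initialLabel (hβε : 0 < m.β * m.ε) (hlam : m.lam ≠ 0) (hτ : 0 < m.τ)
    (hres : m.NonResonant) (k : ℕ) :
    ∀ᵐ ω ∂(m.fockLaw k), m.initialLabel ω = k ∧ ω ∈ m.survives k := by
  have h0 : ∀ᵐ ω ∂(m.fockLaw k), ω ∉ neverEmpty k :=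
    measure_eq_zero_iff_ae_notMem.1 (fockLaw_neverEmpty hβε hlam hτ hres k)
  filter_upwards [h0, ae_fockLaw_W_ne_zero m k] with ω h1 h2
  exact ⟨initialLabel_eq h2 fun l hl h3 => h1 (survives_subset_neverEmpty m hl h3), h2⟩

/-- Only the `n`-th component of the mixture charges the event that the label is `n`. With `B` the
whole space this is the law of the label; with `B` a cylinder it feeds Lévy's theorem. -/
theorem law_initialLabel_inter (hβε : 0 < m.β * m.ε) (hlam : m.lam ≠ 0) (hτ : 0 < m.τ)
    (hres : m.NonResonant) {ρ : Cavity →L[ℂ] Cavity} (hρ : IsState ρ) (n : ℕ) {B : Set Ω}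
    (hB : MeasurableSet B) :
    m.law ρ ({ω | m.initialLabel ω = n} ∩ B) = ENNReal.ofReal (diag ρ n) * m.fockLaw n B := by
  have hA : MeasurableSet {ω | m.initialLabel ω = n} :=
    measurable_initialLabel m (measurableSet_singleton n)
  rw [law_eq_sum m hρ, Measure.sum_apply _ (hA.inter hB), tsum_eq_single n]
  · rw [Measure.smul_apply, smul_eq_mul]
    congr 1
    refine measure_congr ?_
    filter_upwards [ae_fockLaw_initialLabel hβε hlam hτ hres n] with ω h
    refine propext ⟨fun hω => hω.2, fun hω => ⟨h.1, hω⟩⟩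
  · intro k hk
    rw [Measure.smul_apply, smul_eq_mul]
    refine mul_eq_zero_of_right _ (measure_mono_null Set.inter_subset_left ?_)
    refine measure_eq_zero_iff_ae_notMem.2 ?_
    filter_upwards [ae_fockLaw_initialLabel hβε hlam hτ hres k] with ω h h2
    exact hk (h.1.symm.trans h2)

theorem law_initialLabel (hβε : 0 < m.β * m.ε) (hlam : m.lam ≠ 0) (hτ : 0 < m.τ)
    (hres : m.NonResonant) {ρ : Cavity →L[ℂ] Cavity} (hρ : IsState ρ) (n : ℕ) :
    m.law ρ {ω | m.initialLabel ω = n} = ENNReal.ofReal (diag ρ n) := by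
  simpa using law_initialLabel_inter hβε hlam hτ hres hρ n MeasurableSet.univ

theorem ae_law_survives (hβε : 0 < m.β * m.ε) (hlam : m.lam ≠ 0) (hτ : 0 < m.τ)
    (hres : m.NonResonant) {ρ : Cavity →L[ℂ] Cavity} (hρ : IsState ρ) :
    ∀ᵐ ω ∂(m.law ρ), ω ∈ m.survives (m.initialLabel ω) :=
  ae_law m hρ (p := fun ω => ω ∈ m.survives (m.initialLabel ω)) fun k =>
    (ae_fockLaw_initialLabel hβε hlam hτ hres k).mono fun _ h => h.1.symm ▸ h.2

/-! ### The mean of `|n_∞⟩⟨n_∞|` -/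

theorem integrable_ketBra_fock {μ : Measure Ω} [IsFiniteMeasure μ] {n : Ω → ℕ}
    (hn : Measurable n) : Integrable (fun ω => ketBra (fock (n ω))) μ := by
  -- Countability of the labels gives strong measurability, although the space of operators is not
  -- separable.
  have h1 : StronglyMeasurable fun k : ℕ => ketBra (fock k) := StronglyMeasurable.of_discrete
  refine Integrable.of_bound (h1.comp_measurable hn).aestronglyMeasurable 1 (ae_of_all _ fun ω => ?_)
  refine ContinuousLinearMap.opNorm_le_bound _ zero_le_one fun ψ => ?_
  rw [ketBra_apply, norm_smul, norm_fock, mul_one]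
  simpa [norm_fock] using norm_inner_le_norm (𝕜 := ℂ) (fock (n ω)) ψ

theorem inner_integral_ketBra_fock {μ : Measure Ω} [IsFiniteMeasure μ] {n : Ω → ℕ}
    (hn : Measurable n) (i j : ℕ) :
    inner ℂ (fock i) ((∫ ω, ketBra (fock (n ω)) ∂μ) (fock j))
      = if i = j then (μ.real {ω | n ω = i} : ℂ) else 0 := by
  have hint := integrable_ketBra_fock (μ := μ) hn
  have h1 : inner ℂ (fock i) ((∫ ω, ketBra (fock (n ω)) ∂μ) (fock j))
      = ∫ ω, inner ℂ (fock i) (ketBra (fock (n ω)) (fock j)) ∂μ := by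
    rw [← ContinuousLinearMap.apply_apply (𝕜 := ℂ) (fock j),
      ← ContinuousLinearMap.integral_comp_comm _ hint, ← integral_inner]
    · rfl
    · exact ContinuousLinearMap.integrable_comp _ hint
  rw [h1]
  have h2 : ∀ ω, inner ℂ (fock i) (ketBra (fock (n ω)) (fock j))
      = {ω | n ω = i}.indicator (fun _ => if i = j then (1 : ℂ) else 0) ω := fun ω => by
    rw [ketBra_apply, inner_smul_right, inner_fock_fock, inner_fock_fock]
    by_cases h : n ω = i
    · simp [h]
    · simp [h, Ne.symm h]
  simp only [h2]
  rw [integral_indicator_const (s := {ω | n ω = i}) _ (hn (measurableSet_singleton i))]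
  split_ifs <;> simp

theorem ext_inner_fock {S T : Cavity →L[ℂ] Cavity}
    (h : ∀ i j, inner ℂ (fock i) (S (fock j)) = inner ℂ (fock i) (T (fock j))) : S = T := by
  refine ContinuousLinearMap.ext_on
    (Submodule.dense_iff_topologicalClosure_eq_top.2 fockBasis.dense_span) ?_
  rintro _ ⟨j, rfl⟩
  apply fockBasis.repr.injective
  ext i
  rw [← inner_fock, ← inner_fock]
  exact h i j

theorem inner_gibbs (m : Params) (i j : ℕ) :
    inner ℂ (fock i) (m.gibbs (fock j)) = if i = j then (diag m.gibbs i : ℂ) else 0 := by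
  have h : ∀ j, inner ℂ (fock i) (m.gibbs (fock j)) = ((Real.exp (-m.β * m.ε * i) /
      ∑' k : ℕ, Real.exp (-m.β * m.ε * k) : ℝ) : ℂ) * if i = j then 1 else 0 := fun j => by
    rw [inner_fock, repr_gibbs, ← inner_fock, inner_fock_fock]
  rw [diag, h, h, if_pos rfl, mul_one, Complex.ofReal_re]
  split_ifs <;> simp only [mul_one, mul_zero]

/-- Both operators are diagonal in the Fock basis, with the law of the label on the diagonal. -/
theorem integral_ketBra_initialLabel (hβε : 0 < m.β * m.ε) (hlam : m.lam ≠ 0) (hτ : 0 < m.τ)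
    (hres : m.NonResonant) :
    ∫ ω, ketBra (fock (m.initialLabel ω)) ∂(m.law m.gibbs) = m.gibbs := by
  have hg := isState_gibbs m hβε
  have := isProbabilityMeasure_law m hg
  refine ext_inner_fock fun i j => ?_
  rw [inner_integral_ketBra_fock (measurable_initialLabel m), inner_gibbs, measureReal_def,
    law_initialLabel hβε hlam hτ hres hg, ENNReal.toReal_ofReal (hg.diag_nonneg i)]

/-! ### Purification -/

theorem trace_eq_ofReal {X : Cavity →L[ℂ] Cavity} (hX : X.IsPositive) :
    trace X = ((∑' n, diag X n : ℝ) : ℂ) := by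
  rw [trace, Complex.ofReal_tsum]
  exact tsum_congr fun n => Complex.eq_re_of_ofReal_le (hX.inner_nonneg_right (fock n))

theorem traceNorm_of_isPositive {X : Cavity →L[ℂ] Cavity} (hX : X.IsPositive) :
    traceNorm X = ∑' n, ENNReal.ofReal (diag X n) := by
  rw [traceNorm, CFC.abs_of_nonneg _ ((ContinuousLinearMap.nonneg_iff_isPositive _).2 hX)]
  rfl

theorem trace_unnormalized (m : Params) {ρ : Cavity →L[ℂ] Cavity} (hρ : IsState ρ) (t : ℕ)
    (ω : Ω) : trace (m.unnormalized ρ t ω) = ((m.law ρ).real (cyl t ω) : ℂ) := by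
  have hpos := isPositive_unnormalized m hρ t ω
  have h1 : ENNReal.ofReal (trace (m.unnormalized ρ t ω)).re = m.law ρ (cyl t ω) :=
    ((isOutcomeLaw_law m hρ).cylinder t ω).symm
  rw [trace_eq_ofReal hpos] at h1 ⊢
  have h0 : 0 ≤ ∑' n, diag (m.unnormalized ρ t ω) n :=
    tsum_nonneg fun n => hpos.re_inner_nonneg_right (fock n)
  rw [measureReal_def, ← h1, Complex.ofReal_re, ENNReal.toReal_ofReal h0]

theorem diag_smul (r : ℝ) (X : Cavity →L[ℂ] Cavity) (n : ℕ) :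
    diag ((r : ℂ) • X) n = r * diag X n := by
  rw [diag, _root_.smul_apply, inner_smul_right, Complex.re_ofReal_mul, diag]

theorem trajectory_eq (m : Params) {ρ : Cavity →L[ℂ] Cavity} (hρ : IsState ρ) (t : ℕ) (ω : Ω) :
    m.trajectory ρ t ω
      = ((((m.law ρ).real (cyl t ω))⁻¹ : ℝ) : ℂ) • m.unnormalized ρ t ω := by
  rw [Params.trajectory, trace_unnormalized m hρ, Complex.ofReal_inv]

theorem isState_trajectory {ρ : Cavity →L[ℂ] Cavity} (hρ : IsState ρ) {t : ℕ} {ω : Ω}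
    (h : (m.law ρ).real (cyl t ω) ≠ 0) : IsState (m.trajectory ρ t ω) := by
  have hr : 0 ≤ ((m.law ρ).real (cyl t ω))⁻¹ := inv_nonneg.2 measureReal_nonneg
  have hpos : (m.trajectory ρ t ω).IsPositive := by
    rw [trajectory_eq m hρ]
    exact (isPositive_unnormalized m hρ t ω).smul_of_nonneg (Complex.zero_le_real.2 hr)
  refine ⟨hpos, ?_, ?_⟩
  · rw [traceNorm_of_isPositive hpos, trajectory_eq m hρ]
    simp only [diag_smul, ENNReal.ofReal_mul hr]
    rw [ENNReal.tsum_mul_left]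
    exact ENNReal.mul_lt_top ENNReal.ofReal_lt_top
      (tsum_diag_unnormalized_ne_top m hρ t ω).lt_top
  · rw [trace]
    simp only [Params.trajectory, _root_.smul_apply, inner_smul_right]
    rw [tsum_mul_left]
    refine inv_mul_cancel₀ (a := trace (m.unnormalized ρ t ω)) ?_
    rw [trace_unnormalized m hρ]
    exact_mod_cast h

/-- By `law_initialLabel_inter`, the right side is the conditional probability that the initial
label is `k`, given the first `t` outcomes. -/
theorem diag_trajectory {ρ : Cavity →L[ℂ] Cavity} (hρ : IsState ρ) {t : ℕ} {ω : Ω} {k : ℕ}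
    (h : m.W ω t (fock k) ≠ 0) :
    diag (m.trajectory ρ t ω) (k + shift t ω).toNat
      = diag ρ k * ‖m.W ω t (fock k)‖ ^ 2 / (m.law ρ).real (cyl t ω) := by
  rw [trajectory_eq m hρ, diag_smul, diag_unnormalized_of_W_fock_ne_zero m ρ h, inv_mul_eq_div]

/-- The distance depends on `ω` only through the label and the first `t` outcomes, which range over
a countable set. -/
theorem measurable_dist (m : Params) (c : Cavity) (ρ : Cavity →L[ℂ] Cavity) {n : Ω → ℕ}
    (hn : Measurable n) (t : ℕ) : Measurable (m.dist c ρ n t) := by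
  have : m.dist c ρ n t = (fun p : ℕ × (Fin t → Outcome) =>
      traceNorm (m.trajectory ρ t (extendWord p.2) -
        ketBra (ket c (m.evolved t p.1 (extendWord p.2))))) ∘
      fun ω => (n ω, firstOutcomes t ω) := by
    ext1 ω
    have h : ∀ i < t, extendWord (firstOutcomes t ω) i = ω i :=
      fun i hi => extendWord_firstOutcomes hi
    simp only [Function.comp_apply, Params.dist, Params.trajectory, Params.unnormalized,
      evolved_congr m t _ h, W_congr m t _ _ h]
  rw [this]
  exact (measurable_of_countable _).comp (hn.prodMk (measurable_firstOutcomes t))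

theorem norm_ket {c : Cavity} (hc : ‖c‖ = 1) (z : ℤ) : ‖ket c z‖ = 1 := by
  rw [ket]
  split_ifs
  · exact norm_fock _
  · exact hc

/-- A crude bound valid for every label, the cemetery included; it serves as the dominating
function. -/
theorem dist_le {ρ : Cavity →L[ℂ] Cavity} (hρ : IsState ρ) {c : Cavity} (hc : ‖c‖ = 1) {n : Ω → ℕ}
    {t : ℕ} {ω : Ω} (h : (m.law ρ).real (cyl t ω) ≠ 0) : m.dist c ρ n t ω ≤ 6 := by
  have hst := isState_trajectory hρ h
  refine (traceNorm_sub_ketBra_le hst (norm_ket hc _)).trans ?_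
  rw [← ENNReal.ofReal_ofNat]
  refine ENNReal.ofReal_le_ofReal ?_
  have h1 := hst.isPositive.re_inner_nonneg_right (ket c (m.evolved t (n ω) ω))
  have h2 : √(1 - (inner ℂ (ket c (m.evolved t (n ω) ω))
      (m.trajectory ρ t ω (ket c (m.evolved t (n ω) ω)))).re) ≤ 1 :=
    Real.sqrt_le_one.2 (sub_le_self _ h1)
  linarith

theorem dist_le_of_survives {ρ : Cavity →L[ℂ] Cavity} (hρ : IsState ρ) (c : Cavity) {n : Ω → ℕ}
    {t k : ℕ} {ω : Ω} (h : (m.law ρ).real (cyl t ω) ≠ 0) (hk : n ω = k) (hs : ω ∈ m.survives k) :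
    m.dist c ρ n t ω ≤ ENNReal.ofReal (6 * √(1 - diag ρ k *
      ‖m.W ω t (fock k)‖ ^ 2 / (m.law ρ).real (cyl t ω))) := by
  have hst := isState_trajectory hρ h
  rw [← diag_trajectory hρ (hs t), Params.dist, hk, evolved_of_survives hs, ket,
    if_pos (shift_nonneg_of_W_fock_ne_zero (hs t))]
  exact traceNorm_sub_ketBra_le hst (norm_fock _)

theorem ae_law_cyl_ne_zero (m : Params) {ρ : Cavity →L[ℂ] Cavity} (hρ : IsState ρ) :
    ∀ᵐ ω ∂(m.law ρ), ∀ t, (m.law ρ).real (cyl t ω) ≠ 0 := by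
  have := isProbabilityMeasure_law m hρ
  refine ae_all_iff.2 fun t => ?_
  rw [ae_iff]
  refine measure_setOf_eq_zero (t := t) fun ω h => ?_
  exact (measureReal_eq_zero_iff).1 (not_not.1 h)

theorem ae_tendsto_dist (hβε : 0 < m.β * m.ε) (hlam : m.lam ≠ 0) (hτ : 0 < m.τ)
    (hres : m.NonResonant) {ρ : Cavity →L[ℂ] Cavity} (hρ : IsState ρ) (c : Cavity) :
    ∀ᵐ ω ∂(m.law ρ), Tendsto (fun t => m.dist c ρ m.initialLabel t ω) atTop (𝓝 0) := by
  have := isProbabilityMeasure_law m hρ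
  have hA : ∀ n, MeasurableSet {ω | m.initialLabel ω = n} := fun n =>
    measurable_initialLabel m (measurableSet_singleton n)
  have hlevy := ae_all_iff.2 fun n => tendsto_measure_cyl_ratio (m.law ρ) (hA n)
  refine (hlevy.and ((ae_law_survives hβε hlam hτ hres hρ).and (ae_law_cyl_ne_zero m hρ))).mono ?_
  rintro ω ⟨h1, h2, h3⟩
  obtain ⟨k, hk⟩ : ∃ k, m.initialLabel ω = k := ⟨_, rfl⟩
  have h4 := h1 k
  rw [hk] at h2
  rw [Set.indicator_of_mem (show ω ∈ {ω | m.initialLabel ω = k} from hk), Pi.one_apply] at h4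
  have h5 : Tendsto (fun t => diag ρ k * ‖m.W ω t (fock k)‖ ^ 2 /
      (m.law ρ).real (cyl t ω)) atTop (𝓝 1) := by
    -- Lévy's ratio for the event that the label is `k` is the diagonal coefficient of `ρ_t` at `k +
    -- s_t`.
    refine h4.congr fun t => ?_
    have h6 := law_initialLabel_inter hβε hlam hτ hres hρ k (measurableSet_cyl t ω)
    rw [fockLaw_cyl, ← ENNReal.ofReal_mul (hρ.diag_nonneg _)] at h6
    rw [measureReal_def, h6, ENNReal.toReal_ofReal (mul_nonneg (hρ.diag_nonneg _) (sq_nonneg _))]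
  have h7 : Tendsto (fun t => ENNReal.ofReal (6 * √(1 - diag ρ k *
      ‖m.W ω t (fock k)‖ ^ 2 / (m.law ρ).real (cyl t ω)))) atTop (𝓝 0) := by
    have := ENNReal.tendsto_ofReal (((h5.const_sub 1).sqrt).const_mul 6)
    simpa using this
  exact tendsto_of_tendsto_of_tendsto_of_le_of_le tendsto_const_nhds h7 (fun _ => zero_le)
    fun t => dist_le_of_survives hρ c (h3 t) hk h2

end Maser

end

/-! ### The theorem on the one-atom maser -/

theorem theorem2p6 (m : Maser.Params) (hε₀ : 0 < m.ε₀) (hε : 0 < m.ε) (hlam : m.lam ≠ 0)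
    (hτ : 0 < m.τ) (hβ : 0 < m.β) (hres : m.NonResonant) :
    ∃ nInf : Maser.Ω → ℕ, Measurable nInf ∧
      -- the law of `n_∞` under `ℙ^ρ`, and the expectation of `|n_∞⟩⟨n_∞|` under `ℙ^{ρ_inv}`
      (∀ ρ : Maser.Cavity →L[ℂ] Maser.Cavity, Maser.IsState ρ → ∀ n : ℕ,
        m.law ρ {ω | nInf ω = n} =
          ENNReal.ofReal (inner ℂ (Maser.fock n) (ρ (Maser.fock n))).re) ∧
      (Integrable (fun ω => Maser.ketBra (Maser.fock (nInf ω))) (m.law m.gibbs) ∧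
        ∫ ω, Maser.ketBra (Maser.fock (nInf ω)) ∂(m.law m.gibbs) = m.gibbs) ∧
      -- no extinction when starting from `n_∞`
      (∀ᵐ ω ∂(m.law m.gibbs), m.extinctionTime (nInf ω) ω = ⊤) ∧
      (∀ ρ : Maser.Cavity →L[ℂ] Maser.Cavity, Maser.IsState ρ →
        ∀ᵐ ω ∂(m.law ρ), m.extinctionTime (nInf ω) ω = ⊤) ∧
      -- purification, almost surely and in `L¹`, for any choice of the cemetery vector
      (∀ c : Maser.Cavity, ‖c‖ = 1 → (∀ k : ℕ, c ≠ Maser.fock k) →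
        ∀ ρ : Maser.Cavity →L[ℂ] Maser.Cavity, Maser.IsState ρ →
          (∀ᵐ ω ∂(m.law ρ), Tendsto (fun t => m.dist c ρ nInf t ω) atTop (𝓝 0)) ∧
          (∀ t, Measurable (m.dist c ρ nInf t)) ∧
          (∀ t, ∫⁻ ω, m.dist c ρ nInf t ω ∂(m.law ρ) < ∞) ∧
          Tendsto (fun t => ∫⁻ ω, m.dist c ρ nInf t ω ∂(m.law ρ)) atTop (𝓝 0)) := by
  have hβε : 0 < m.β * m.ε := mul_pos hβ hε
  have hg := Maser.isState_gibbs m hβε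
  have hgp := Maser.isProbabilityMeasure_law m hg
  have hext : ∀ ρ : Maser.Cavity →L[ℂ] Maser.Cavity, Maser.IsState ρ →
      ∀ᵐ ω ∂(m.law ρ), m.extinctionTime (m.initialLabel ω) ω = ⊤ := fun ρ hρ =>
    (Maser.ae_law_survives hβε hlam hτ hres hρ).mono fun ω h => Maser.extinctionTime_eq_top h
  refine ⟨m.initialLabel, Maser.measurable_initialLabel m,
    fun ρ hρ n => Maser.law_initialLabel hβε hlam hτ hres hρ n,
    ⟨Maser.integrable_ketBra_fock (Maser.measurable_initialLabel m),
      Maser.integral_ketBra_initialLabel hβε hlam hτ hres⟩, hext _ hg, hext, ?_⟩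
  intro c hc _ ρ hρ
  have := Maser.isProbabilityMeasure_law m hρ
  have hmeas := Maser.measurable_dist m c ρ (Maser.measurable_initialLabel m)
  have hlim := Maser.ae_tendsto_dist hβε hlam hτ hres hρ c
  have hle : ∀ t, ∀ᵐ ω ∂(m.law ρ), m.dist c ρ m.initialLabel t ω ≤ 6 := fun t =>
    (Maser.ae_law_cyl_ne_zero m hρ).mono fun ω h => Maser.dist_le hρ hc (h t)
  refine ⟨hlim, hmeas, fun t => ?_, ?_⟩
  · refine (lintegral_mono_ae (hle t)).trans_lt ?_
    simp
  · have := tendsto_lintegral_of_dominated_convergence (fun _ => 6) hmeas hle (by simp) hlim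
    simpa using this
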